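/- **Setting.** Let $\mathbb G$ be a set and let $H$ be a symmetric operator with locally finite hopping, given by matrix elements $H(x,y)=\langle\delta_x,H\delta_y\rangle=\overline{H(y,x)}$ such that for every $x$ only finitely many $H(x,y)$ are non-zero. Let $H_{\min}$ be its restriction to the finitely supported vectors in $\ell^2(\mathbb G)$, and $H_{\min}^*$ the Hilbert space adjoint. Inner products are antilinear in the first argument. Let $\mathbb G=\bigsqcup_{n\ge0}S_n$ be a partition into finite shells with $H(x,y)=0$ whenever $x\in S_j$, $y\in S_k$, $|j-k|\ge2$. Let $P_n:\ell^2(S_n)\to\ell^2(\mathbb G)$ be the canonical embedding. For $n\ge 0$ write $P_{n+1}^*HP_n=-\Upsilon_{n+1}\Phi_n^*$ with matrices $\Upsilon_{n+1}\in\mathbb C^{S_{n+1}\times r_{n+1}}$, $\Phi_n\in\mathbb C^{S_n\times r_{n+1}}$ of full rank $r_{n+1}$, and let $r_0=1$ and $0\ne\Upsilon_0\in\mathbb C^{S_0}$ be a root vector. For $m\le n$ let $H_{m,n}$ be the (finite) compression of $H$ to $\ell^2(S_m\sqcup\dots\sqcup S_n)$ and, viewing $\Upsilon_m$ and $\Phi_n$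 as matrices with rows indexed by $S_m\sqcup\dots\sqcup S_n$ (extended by zero), $$R^z_{m,n}=\begin{pmatrix}\alpha^z_{m,n}&\beta^z_{m,n}\\ \gamma^z_{m,n}&\delta^z_{m,n}\end{pmatrix}=\begin{pmatrix}\Upsilon_m^*\\ \Phi_n^*\end{pmatrix}(H_{m,n}-z)^{-1}\begin{pmatrix}\Upsilon_m&\Phi_n\end{pmatrix},$$ extended analytically to those points of the spectrum of $H_{m,n}$ where this is possible. Let $A_{m,n}$ be the set of all $z\in\mathbb C$ such that either $z$ is real and $R_{m,n}$ has no analytic extension to $z$, or $\operatorname{rank}\beta^z_{m,n}<r_m$; put $A_n=A_{n,n}$. Assume (A1) $r_n\le r_{n+1}$ for all $n\ge0$; (A2) for all $n\ge0$ and Lebesgue almost all $\lambda\in\mathbb R$ the matrix $\beta^\lambda_{n,n}$ has full rank $r_n$. **Theorem.** Let $\operatorname{Im}z>0$ and let the $n$-th Weyl disc be $$\mathbb W^z_n=\operatorname{cl}\left\{\alpha^z_{0,n}+\beta^z_{0,n}A(\mathbf 1-\delta^z_{0,n}A)^{-1}\gamma^z_{0,n}\;:\;A\in\mathbb C^{r_{n+1}\times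 r_{n+1}},\ \tfrac1{2i}(A-A^*)\ge 0\right\}\subset\mathbb C .$$ (i) Every $\mathbb W^z_n$ is a closed circular disc, of positive radius if and only if $z,\bar z\notin A_{0,n}$ (otherwise it is a single point). It lies in the closed upper half plane, and in the open upper half plane if $n\ge1$. Moreover $\mathbb W^z_{n+1}\subset\mathbb W^z_n$, and $\bigcap_{n\ge0}\mathbb W^z_n$ is either a closed disc of positive radius (limit circle case) or a single point (limit point case). (ii) If one of the deficiency indices $d^\pm=\dim\ker(H_{\min}^*\pm i)$ is zero, then $\bigcap_{n\ge0}\mathbb W^z_n$ consists of one point. If $H=H_{\min}^*$ is self-adjoint, then the bounded resolvent $(H-z)^{-1}$ exists and $$\bigl\{\langle P_0\Upsilon_0,(H-z)^{-1}P_0\Upsilon_0\rangle\bigr\}=\bigcap_{n\ge0}\mathbb W^z_n .$$ (iii) Let $z,\bar z\notin\bigcup_{n\ge0}A_n$. Then $\bigcap_{n\ge0}\mathbb W^z_n$ is a closed disc of positive radius if and only if there are $\psi^+,\psi^-\in\ell^2(\mathbb G)$, both in the domain of $H_{\min}^*$, with $\langle P_0\Upsilon_0,\psi^\pm\rangle\ne0$,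 $H_{\min}^*\psi^+=z\psi^+$ and $H_{\min}^*\psi^-=\bar z\psi^-$. -/

import Mathlib

open Filter Topology MeasureTheory
open scoped ComplexConjugate Matrix LinearPMap

noncomputable section

/-- The Hilbert space `ℓ²(G)` of square summable functions `G → ℂ`; the inner product `inner ℂ`
is antilinear in the first and linear in the second argument. -/
abbrev EllTwo (G : Type*) := lp (fun _ : G => ℂ) 2

/-- A symmetric operator with locally finite hopping on a set `G`, given by its matrix elements
`entry x y = ⟨δ_x, H δ_y⟩`. -/
structure HoppingOperator (G : Type*) where
  entry : G → G → ℂ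
  symmetric : ∀ x y, entry x y = conj (entry y x)
  locallyFinite : ∀ x, {y | entry x y ≠ 0}.Finite

namespace HoppingOperator

variable {G : Type*} (H : HoppingOperator G)

/-- The natural action of `H` on all functions `G → ℂ`: `(H ψ)(x) = ∑_y ⟨δ_x, H δ_y⟩ ψ(y)`,
a finite sum for every `x`. -/
def formal : (G → ℂ) →ₗ[ℂ] (G → ℂ) where
  toFun ψ x := ∑ y ∈ (H.locallyFinite x).toFinset, H.entry x y * ψ y
  map_add' ψ φ := by
    funext x
    simp [mul_add, Finset.sum_add_distrib]
  map_smul' c ψ := by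
    funext x
    simp only [Pi.smul_apply, smul_eq_mul, RingHom.id_apply, Finset.mul_sum]
    exact Finset.sum_congr rfl fun y _ => by ring

/-- The space of compactly (that is, finitely) supported vectors in `ℓ²(G)`. -/
def compactlySupported (G : Type*) : Submodule ℂ (EllTwo G) where
  carrier := {ψ | (Function.support (ψ : G → ℂ)).Finite}
  add_mem' {ψ φ} hψ hφ := by
    refine (hψ.union hφ).subset ?_
    rw [lp.coeFn_add]
    exact Function.support_add _ _
  zero_mem' := by simp [Function.support]
  smul_mem' c ψ hψ := by
    refine Set.Finite.subset hψ ?_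
    rw [lp.coeFn_smul]
    exact Function.support_const_smul_subset c _

theorem memlp_of_finite_support {f : G → ℂ} (hf : (Function.support f).Finite) :
    Memℓp (E := fun _ : G => ℂ) f 2 :=
  (memℓp_zero hf).of_exponent_ge zero_le

theorem formal_finite_support {ψ : G → ℂ} (hψ : (Function.support ψ).Finite) :
    (Function.support (H.formal ψ)).Finite := by
  refine (hψ.biUnion fun y _ => H.locallyFinite y).subset fun x hx => ?_
  obtain ⟨y, -, hy⟩ := Finset.exists_ne_zero_of_sum_ne_zero hx
  refine Set.mem_biUnion (x := y) (right_ne_zero_of_mul hy) ?_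
  intro h0
  exact left_ne_zero_of_mul hy (by rw [H.symmetric, h0, map_zero])

/-- `H_min`: the restriction of `H` to the compactly supported vectors, as an unbounded operator
on `ℓ²(G)`. -/
def Hmin : EllTwo G →ₗ.[ℂ] EllTwo G where
  domain := compactlySupported G
  toFun :=
    { toFun := fun ψ =>
        ⟨H.formal (ψ : EllTwo G), memlp_of_finite_support (H.formal_finite_support ψ.2)⟩
      map_add' := fun ψ φ => by
        apply lp.ext
        exact H.formal.map_add (ψ : EllTwo G) (φ : EllTwo G)
      map_smul' := fun c ψ => by
        apply lp.ext
        simp }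

/-- `H_min^*`, the operator with its natural (maximal) domain. -/
def Hmax : EllTwo G →ₗ.[ℂ] EllTwo G := (H.Hmin)†

end HoppingOperator

/-- `dim ker (T - w)` for an unbounded operator `T`. -/
def dimKer {E : Type*} [AddCommGroup E] [Module ℂ E] (T : E →ₗ.[ℂ] E) (w : ℂ) : Cardinal :=
  Module.rank ℂ (LinearMap.ker (T.toFun - w • T.domain.subtype))

/-- The vector `ψ` lies in the domain of `T` and `T ψ = w ψ`. -/
def IsSolution {E : Type*} [AddCommGroup E] [Module ℂ E] (T : E →ₗ.[ℂ] E) (w : ℂ) (ψ : E) : Prop :=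
  ∃ h : ψ ∈ T.domain, T ⟨ψ, h⟩ = w • ψ

/-- The bounded operator `R` is the resolvent `(T - w)⁻¹` of the unbounded operator `T`. -/
def IsResolvent {E : Type*} [NormedAddCommGroup E] [NormedSpace ℂ E] (T : E →ₗ.[ℂ] E) (w : ℂ)
    (R : E →L[ℂ] E) : Prop :=
  (∀ x : E, ∃ h : R x ∈ T.domain, T ⟨R x, h⟩ - w • R x = x) ∧
    ∀ y : T.domain, R (T y - w • (y : E)) = y

/-- A quasi-spherical partition of `G` into finite shells `S_n = {x | shell x = n}`, such that `H`
only connects equal and neighbouring shells, together with full rank factorizations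
`W_{n+1} = - Υ_{n+1} Φ_n^*` of the connection matrices `W_{n+1} = P_{n+1}^* H P_n` and a non-zero
root vector `Υ_0 ∈ ℓ²(S_0)` (so `r_0 = 1`).  For `n ≥ 1` the factorization makes
`r n` the rank of `W_n`. -/
structure QuasiSphericalPartition {G : Type*} (H : HoppingOperator G) where
  shell : G → ℕ
  shell_finite : ∀ n, {x | shell x = n}.Finite
  entry_eq_zero : ∀ x y, (shell x + 2 ≤ shell y ∨ shell y + 2 ≤ shell x) → H.entry x y = 0
  r : ℕ → ℕ
  r_zero : r 0 = 1
  Υ : ∀ n, Matrix {x // shell x = n} (Fin (r n)) ℂ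
  Φ : ∀ n, Matrix {x // shell x = n} (Fin (r (n + 1))) ℂ
  rank_Υ : ∀ n, (Υ n).rank = r n
  rank_Φ : ∀ n, (Φ n).rank = r (n + 1)
  factorization : ∀ n,
    (Matrix.of fun (x : {x // shell x = n + 1}) (y : {x // shell x = n}) => H.entry x y) =
      -(Υ (n + 1) * (Φ n)ᴴ)

namespace QuasiSphericalPartition

variable {G : Type*} {H : HoppingOperator G} (Q : QuasiSphericalPartition H)

/-- `𝔾_{m,n}`, the union of the shells `S_m, …, S_n`. -/
abbrev Slab (m n : ℕ) : Type _ := {x : G // m ≤ Q.shell x ∧ Q.shell x ≤ n}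

instance slabFintype (m n : ℕ) : Fintype (Q.Slab m n) :=
  Set.Finite.fintype (s := {x : G | m ≤ Q.shell x ∧ Q.shell x ≤ n})
    (((Set.finite_Icc m n).biUnion fun k _ => Q.shell_finite k).subset fun x hx =>
      Set.mem_biUnion (x := Q.shell x) hx rfl)

instance slabDecidableEq (m n : ℕ) : DecidableEq (Q.Slab m n) := Classical.decEq _

/-- `H_{m,n} = P_{m,n}^* H P_{m,n}`. -/
def Hpart (m n : ℕ) : Matrix (Q.Slab m n) (Q.Slab m n) ℂ :=
  Matrix.of fun x y => H.entry x y

/-- `P_{m,n}^* P_m Υ_m`. -/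
def ΥEmb (m n : ℕ) : Matrix (Q.Slab m n) (Fin (Q.r m)) ℂ :=
  Matrix.of fun x j => if h : Q.shell x = m then Q.Υ m ⟨x, h⟩ j else 0

/-- `P_{m,n}^* P_n Φ_n`. -/
def ΦEmb (m n : ℕ) : Matrix (Q.Slab m n) (Fin (Q.r (n + 1))) ℂ :=
  Matrix.of fun x j => if h : Q.shell x = n then Q.Φ n ⟨x, h⟩ j else 0

/-- The boundary resolvent data given by the resolvent formula, meaningful for `z` outside the
spectrum of `H_{m,n}`. -/
def resolventData (m n : ℕ) (z : ℂ) :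
    Matrix (Fin (Q.r m) ⊕ Fin (Q.r (n + 1))) (Fin (Q.r m) ⊕ Fin (Q.r (n + 1))) ℂ :=
  (Matrix.fromCols (Q.ΥEmb m n) (Q.ΦEmb m n))ᴴ * (Q.Hpart m n - z • 1)⁻¹ *
    Matrix.fromCols (Q.ΥEmb m n) (Q.ΦEmb m n)

open Classical in
/-- The boundary data `R^z_{m,n}`: the resolvent formula off the spectrum of `H_{m,n}`, and its
analytic extension, where there is one, on the spectrum. -/
def R (m n : ℕ) (z : ℂ) :
    Matrix (Fin (Q.r m) ⊕ Fin (Q.r (n + 1))) (Fin (Q.r m) ⊕ Fin (Q.r (n + 1))) ℂ :=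
  if IsUnit (Q.Hpart m n - z • 1) then Q.resolventData m n z
  else Matrix.of fun i j => limUnder (𝓝[≠] z) fun w => Q.resolventData m n w i j

/-- `α^z_{m,n}`. -/
def α (m n : ℕ) (z : ℂ) : Matrix (Fin (Q.r m)) (Fin (Q.r m)) ℂ := (Q.R m n z).toBlocks₁₁

/-- `β^z_{m,n}`. -/
def β (m n : ℕ) (z : ℂ) : Matrix (Fin (Q.r m)) (Fin (Q.r (n + 1))) ℂ := (Q.R m n z).toBlocks₁₂

/-- `γ^z_{m,n}`. -/
def γ (m n : ℕ) (z : ℂ) : Matrix (Fin (Q.r (n + 1))) (Fin (Q.r m)) ℂ := (Q.R m n z).toBlocks₂₁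

/-- `δ^z_{m,n}`. -/
def δ (m n : ℕ) (z : ℂ) : Matrix (Fin (Q.r (n + 1))) (Fin (Q.r (n + 1))) ℂ :=
  (Q.R m n z).toBlocks₂₂

/-- `A¹_{m,n}`: the real numbers at which the boundary data have no analytic extension. -/
def A1Set (m n : ℕ) : Set ℂ :=
  {z | z.im = 0 ∧ ¬ ∀ i j, ∃ f : ℂ → ℂ, AnalyticAt ℂ f z ∧
    f =ᶠ[𝓝[≠] z] fun w => Q.resolventData m n w i j}

/-- `A²_{m,n}`: the complex numbers at which `β^z_{m,n}` does not have full rank `r_m`. -/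
def A2Set (m n : ℕ) : Set ℂ := {z | (Q.β m n z).rank < Q.r m}

/-- The singular spectral parameters `A_{m,n}`; `A_n` is `A_{n,n}`. -/
def ASet (m n : ℕ) : Set ℂ := Q.A1Set m n ∪ Q.A2Set m n

/-- Assumption (A1): the ranks are non-decreasing. -/
def AssumptionA1 : Prop := ∀ n, Q.r n ≤ Q.r (n + 1)

/-- Assumption (A2): `β^λ_n` has full rank `r_n` for all `n` and Lebesgue almost all real `λ`. -/
def AssumptionA2 : Prop := ∀ n, ∀ᵐ l : ℝ, (Q.β n n (l : ℂ)).rank = Q.r n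

/-- The only index in `Fin (r 0)`. -/
def rootIndex : Fin (Q.r 0) := ⟨0, Q.r_zero ▸ Nat.zero_lt_one⟩

/-- The root vector `P_0 Υ_0` in `ℓ²(G)`. -/
def root : EllTwo G :=
  ⟨fun x => if h : Q.shell x = 0 then Q.Υ 0 ⟨x, h⟩ Q.rootIndex else 0,
    HoppingOperator.memlp_of_finite_support ((Q.shell_finite 0).subset fun x hx => by
      by_contra h
      exact hx (dif_neg h))⟩

open scoped ComplexOrder in
/-- The `n`-th Weyl disc: the closure of the set of all
`α^z_{0,n} + β^z_{0,n} A (1 - δ^z_{0,n} A)⁻¹ γ^z_{0,n}` (`1 × 1` matrices, read as numbers) with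
`(A - A^*) / (2i) ≥ 0`. -/
def weylDisc (n : ℕ) (z : ℂ) : Set ℂ :=
  closure {w | ∃ A : Matrix (Fin (Q.r (n + 1))) (Fin (Q.r (n + 1))) ℂ,
    ((2 * Complex.I)⁻¹ • (A - Aᴴ)).PosSemidef ∧
    w = (Q.α 0 n z + Q.β 0 n z * (A * (1 - Q.δ 0 n z * A)⁻¹) * Q.γ 0 n z)
      Q.rootIndex Q.rootIndex}

end QuasiSphericalPartition

end

/-! ### Balls under linear functionals; nested discs. -/

section Geometry

variable {F : Type*} [NormedAddCommGroup F] [InnerProductSpace ℂ F]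

/-! The Möbius parametrization is replaced by a boundary value problem. On the first shells let `M`
be the compression of `H`, `u` the root and `Φ` the boundary modes. The disc consists of the numbers
`⟨u, φ⟩` for solutions of `(M - z) φ = u + Φ f` whose flux `Im ⟨Φ^* φ, f⟩` is non-negative. By
Green's formula (`im_flux_eq`) this says `Im z ‖φ‖² ≤ Im ⟨u, φ⟩`. A condition `f = A Φ^* φ` with `Im
A ≥ 0` gives non-negative flux, and a positive flux is realized by a rank one `A`
(`moebiusSet_subset`, `mem_moebiusSet`). In this form nesting is immediate: restricting a solution
to fewer shells keeps `⟨u, φ⟩` and lowers the norm.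

With `e = (M - z)⁻¹ Φ f` and `t = Im z`, the flux condition reads `t² ‖e‖² ≤ t Im ⟨b, e⟩`, a ball in
`e`, and the value is affine, `c + ⟨a, e⟩`. So the set is a disc of radius `‖a‖ ‖b‖ / (2 |t|)`. The
functionals `a` and `b` are those of `β` at `z` and at `conj z`, which gives the criterion for a
positive radius, and the set at `conj z` is the conjugate disc
(`finiteWeylSet_disc_of_linearEquiv`).

Truncations of solutions `ψ±` of `H ψ = z ψ` and `H ψ = conj z ψ` have the form of such `e`, so
Cauchy–Schwarz bounds `|⟨u, ψ+⟩| |⟨u, ψ-⟩|` by `2 Im z ρ_n ‖ψ+‖ ‖ψ-‖`; in the limit, suitable `ψ±`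
force a positive limit radius. Conversely, by compactness a point of all discs comes from a square
summable solution of `(H - z) ψ = u`, and two different points yield a homogeneous solution by
subtraction. A limit circle therefore produces solutions in both half planes. This contradicts a
vanishing deficiency index, because triviality of the defect is constant on each half plane
(`HasTrivialDefect.of_half_plane`). In the self-adjoint case the resolvent applied to the root
satisfies the disc inequality on every truncation. -/

theorem image_inner_closedBall (a e₀ : F) {R : ℝ} (hR : 0 ≤ R) :
    (fun e => inner ℂ a e) '' Metric.closedBall e₀ R =
      Metric.closedBall (inner ℂ a e₀) (‖a‖ * R) := by
  ext w
  simp only [Set.mem_image, Metric.mem_closedBall, dist_eq_norm]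
  constructor
  · rintro ⟨e, he, rfl⟩
    rw [← inner_sub_right]
    exact (norm_inner_le_norm _ _).trans (by gcongr)
  · intro hw
    rcases eq_or_ne a 0 with rfl | ha
    · refine ⟨e₀, by simpa using hR, ?_⟩
      simp only [inner_zero_left, norm_zero, zero_mul, sub_zero, norm_le_zero_iff] at hw ⊢
      exact hw.symm
    · have ha' : 0 < ‖a‖ := norm_pos_iff.2 ha
      have hac : (‖a‖ : ℂ) ≠ 0 := by exact_mod_cast ha'.ne'
      -- The shortest correction of `e₀` that reaches the value `w` is along `a`.
      refine ⟨e₀ + ((w - inner ℂ a e₀) / (‖a‖ : ℂ) ^ 2) • a, ?_, ?_⟩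
      · rw [add_sub_cancel_left, norm_smul, norm_div, norm_pow, Complex.norm_real, norm_norm]
        rw [div_mul_eq_mul_div, div_le_iff₀ (by positivity)]
        nlinarith
      · rw [inner_add_right, inner_smul_right, inner_self_eq_norm_sq_to_K]
        simp only [Complex.coe_algebraMap]
        field_simp
        ring

/-- Completing the square: the flux inequality describes a ball with `0` on its boundary. The sign
of `t` is left free so that both half planes are covered. -/
theorem norm_sub_halfAxis_sq (b e : F) {t : ℝ} (ht : t ≠ 0) :
    ‖e - (Complex.I / (2 * t)) • b‖ ^ 2 - (‖b‖ / (2 * |t|)) ^ 2 =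
      (t ^ 2 * ‖e‖ ^ 2 - t * (inner ℂ b e).im) / t ^ 2 := by
  have h1 : (inner ℂ e ((Complex.I / (2 * t)) • b)).re = (inner ℂ b e).im / (2 * t) := by
    rw [inner_smul_right, ← inner_conj_symm e b]
    have : (Complex.I / (2 * t)) = ((1 / (2 * t) : ℝ) : ℂ) * Complex.I := by
      push_cast; ring
    rw [this, mul_assoc, Complex.re_ofReal_mul, Complex.I_mul_re, Complex.conj_im]
    ring
  have h2 : ‖(Complex.I / (2 * t)) • b‖ ^ 2 = (‖b‖ / (2 * |t|)) ^ 2 := by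
    rw [norm_smul, norm_div]
    simp
    ring
  rw [@norm_sub_sq ℂ, RCLike.re_eq_complex_re, h1, h2]
  field_simp
  ring

theorem mem_ellipsoid_iff (b e : F) {t : ℝ} (ht : t ≠ 0) :
    t ^ 2 * ‖e‖ ^ 2 ≤ t * (inner ℂ b e).im ↔
      e ∈ Metric.closedBall ((Complex.I / (2 * t)) • b) (‖b‖ / (2 * |t|)) := by
  have h := norm_sub_halfAxis_sq b e ht
  have ht2 : 0 < t ^ 2 := by positivity
  rw [Metric.mem_closedBall, dist_eq_norm,
    ← sq_le_sq₀ (norm_nonneg _) (by positivity), ← sub_nonpos (b := (‖b‖ / (2 * |t|)) ^ 2), h,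
    div_le_iff₀ ht2, zero_mul, sub_nonpos]

theorem mem_ellipsoid_interior_iff (b e : F) {t : ℝ} (ht : t ≠ 0) :
    t ^ 2 * ‖e‖ ^ 2 < t * (inner ℂ b e).im ↔
      e ∈ Metric.ball ((Complex.I / (2 * t)) • b) (‖b‖ / (2 * |t|)) := by
  have h := norm_sub_halfAxis_sq b e ht
  have ht2 : 0 < t ^ 2 := by positivity
  rw [Metric.mem_ball, dist_eq_norm,
    ← sq_lt_sq₀ (norm_nonneg _) (by positivity), ← sub_neg (b := (‖b‖ / (2 * |t|)) ^ 2), h,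
    div_lt_iff₀ ht2, zero_mul, sub_neg]

theorem image_ellipsoid (c : ℂ) (a b : F) {t : ℝ} (ht : t ≠ 0) :
    {w | ∃ e : F, w = c + inner ℂ a e ∧ t ^ 2 * ‖e‖ ^ 2 ≤ t * (inner ℂ b e).im} =
      Metric.closedBall (c + Complex.I * inner ℂ a b / (2 * t)) (‖a‖ * ‖b‖ / (2 * |t|)) := by
  have h := image_inner_closedBall a ((Complex.I / (2 * t)) • b)
    (R := ‖b‖ / (2 * |t|)) (by positivity)
  ext w
  have hw : w ∈ Metric.closedBall (c + Complex.I * inner ℂ a b / (2 * t))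
      (‖a‖ * ‖b‖ / (2 * |t|)) ↔ w - c ∈ Metric.closedBall
        (inner ℂ a ((Complex.I / (2 * t)) • b)) (‖a‖ * (‖b‖ / (2 * |t|))) := by
    rw [Metric.mem_closedBall, Metric.mem_closedBall, dist_eq_norm, dist_eq_norm,
      inner_smul_right, sub_sub, div_mul_eq_mul_div, mul_div_assoc ‖a‖]
  rw [hw, ← h]
  simp only [Set.mem_ofPred_eq, Set.mem_image, mem_ellipsoid_iff _ _ ht]
  constructor
  · rintro ⟨e, rfl, he⟩
    exact ⟨e, he, by ring⟩
  · rintro ⟨e, he, h⟩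
    exact ⟨e, by rw [h]; ring, he⟩

/-- The points given by the interior of the ellipsoid and by its boundary point `0` are dense in
the disc. -/
theorem subset_closure_image_ellipsoid_interior (c : ℂ) (a b : F) {t : ℝ} (ht : t ≠ 0) :
    {w | ∃ e : F, w = c + inner ℂ a e ∧ t ^ 2 * ‖e‖ ^ 2 ≤ t * (inner ℂ b e).im} ⊆
      closure {w | ∃ e : F, w = c + inner ℂ a e ∧
        (e = 0 ∨ t ^ 2 * ‖e‖ ^ 2 < t * (inner ℂ b e).im)} := by
  rintro w ⟨e, rfl, he⟩
  rcases eq_or_ne b 0 with rfl | hb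
  · refine subset_closure ⟨e, rfl, Or.inl ?_⟩
    have ht2 : 0 < t ^ 2 := by positivity
    simp only [inner_zero_left, Complex.zero_im, mul_zero] at he
    have : ‖e‖ ^ 2 ≤ 0 := by nlinarith
    simpa using this
  · have hR : ‖b‖ / (2 * |t|) ≠ 0 := by
      have := norm_ne_zero_iff.2 hb
      positivity
    rw [mem_ellipsoid_iff _ _ ht, ← closure_ball _ hR] at he
    have hc : Continuous fun e : F => c + inner ℂ a e := by fun_prop
    refine closure_mono ?_ (image_closure_subset_closure_image hc (Set.mem_image_of_mem _ he))
    rintro _ ⟨e', he', rfl⟩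
    exact ⟨e', rfl, Or.inr ((mem_ellipsoid_interior_iff _ _ ht).2 he')⟩

/-- Test the inclusion at the point of the inner disc farthest from `c`. -/
theorem dist_add_le_of_closedBall_subset {c c' : ℂ} {ρ ρ' : ℝ} (hρ' : 0 ≤ ρ')
    (h : Metric.closedBall c' ρ' ⊆ Metric.closedBall c ρ) : dist c' c + ρ' ≤ ρ := by
  rcases eq_or_ne c' c with rfl | hne
  · have hm : c' + (ρ' : ℂ) ∈ Metric.closedBall c' ρ' := by
      simp [abs_of_nonneg hρ']
    have := h hm
    simpa [abs_of_nonneg hρ'] using this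
  · have hd : 0 < ‖c' - c‖ := norm_pos_iff.2 (sub_ne_zero.2 hne)
    have hdc : (‖c' - c‖ : ℂ) ≠ 0 := by exact_mod_cast hd.ne'
    have hm : c' + ((ρ' / ‖c' - c‖ : ℝ) : ℂ) * (c' - c) ∈ Metric.closedBall c' ρ' := by
      rw [Metric.mem_closedBall, dist_eq_norm, add_sub_cancel_left, norm_mul, Complex.norm_real,
        Real.norm_of_nonneg (by positivity), div_mul_cancel₀ _ hd.ne']
    have := h hm
    rw [Metric.mem_closedBall, dist_eq_norm] at this
    have e : c' + ((ρ' / ‖c' - c‖ : ℝ) : ℂ) * (c' - c) - c =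
        ((1 + ρ' / ‖c' - c‖ : ℝ) : ℂ) * (c' - c) := by push_cast; ring
    rw [e, norm_mul, Complex.norm_real, Real.norm_of_nonneg (by positivity), add_mul,
      div_mul_cancel₀ _ hd.ne', one_mul] at this
    rwa [dist_eq_norm]

/-- The intersection of a decreasing sequence of closed discs is a closed disc, whose radius is
the limit of the radii. -/
theorem iInter_closedBall_of_antitone {c : ℕ → ℂ} {ρ : ℕ → ℝ} (hρ : ∀ n, 0 ≤ ρ n)
    (h : ∀ n, Metric.closedBall (c (n + 1)) (ρ (n + 1)) ⊆ Metric.closedBall (c n) (ρ n)) :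
    ∃ (c₀ : ℂ) (ρ₀ : ℝ), Tendsto ρ atTop (𝓝 ρ₀) ∧ 0 ≤ ρ₀ ∧
      (⋂ n, Metric.closedBall (c n) (ρ n)) = Metric.closedBall c₀ ρ₀ := by
  have hanti : Antitone fun n => Metric.closedBall (c n) (ρ n) := antitone_nat_of_succ_le h
  have hdist : ∀ {m n}, m ≤ n → dist (c n) (c m) + ρ n ≤ ρ m := fun hmn =>
    dist_add_le_of_closedBall_subset (hρ _) (hanti hmn)
  have hρa : Antitone ρ := fun m n hmn => by
    have := hdist hmn
    have := dist_nonneg (x := c n) (y := c m)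
    linarith
  have hbdd : BddBelow (Set.range ρ) := ⟨0, by rintro _ ⟨n, rfl⟩; exact hρ n⟩
  have hlim := tendsto_atTop_ciInf hρa hbdd
  set ρ₀ := ⨅ n, ρ n
  have hle : ∀ n, ρ₀ ≤ ρ n := fun n => ciInf_le hbdd n
  -- Nesting bounds the distance of two centres by the difference of the radii, which converge.
  have hc : CauchySeq c := by
    refine cauchySeq_of_le_tendsto_0' (fun n => ρ n - ρ₀) (fun n m hnm => ?_) ?_
    · rw [dist_comm]
      have := hdist hnm
      have := hle m
      linarith
    · simpa using hlim.sub_const ρ₀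
  obtain ⟨c₀, hc₀⟩ := cauchySeq_tendsto_of_complete hc
  refine ⟨c₀, ρ₀, hlim, le_ciInf hρ, ?_⟩
  ext w
  simp only [Set.mem_iInter, Metric.mem_closedBall]
  constructor
  · intro hw
    exact le_of_tendsto_of_tendsto' (tendsto_const_nhds.dist hc₀) hlim hw
  · intro hw n
    have h1 : dist c₀ (c n) + ρ₀ ≤ ρ n := by
      refine le_of_tendsto ((hc₀.dist tendsto_const_nhds).add hlim) ?_
      filter_upwards [eventually_ge_atTop n] with m hm using hdist hm
    have := dist_triangle w c₀ (c n)
    linarith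

end Geometry

/-! ### Green's formula and the Weyl set of a finite Hermitian matrix. -/

section FiniteWeyl

variable {V ι : Type*} [Fintype V] [DecidableEq V] [Fintype ι]

theorem star_dotProduct_self_eq_sum {V : Type*} [Fintype V] (φ : V → ℂ) :
    star φ ⬝ᵥ φ = ((∑ x, ‖φ x‖ ^ 2 : ℝ) : ℂ) := by
  simp only [dotProduct, Pi.star_apply, RCLike.star_def, Complex.conj_mul']
  push_cast
  rfl

/-- Green's formula: for a solution of `(M - z) φ = u + Φ f` the flux through the boundary `Φ`
equals the flux at `u` minus the dissipation. -/
theorem im_flux_eq {M : Matrix V V ℂ} (hM : M.IsHermitian) {z : ℂ} {u φ : V → ℂ}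
    {Φ : Matrix V ι ℂ} {f : ι → ℂ} (h : (M - z • 1) *ᵥ φ = u + Φ *ᵥ f) :
    (star (Φᴴ *ᵥ φ) ⬝ᵥ f).im = (star u ⬝ᵥ φ).im - z.im * ∑ x, ‖φ x‖ ^ 2 := by
  have h1 : star φ ⬝ᵥ M *ᵥ φ = z * ((∑ x, ‖φ x‖ ^ 2 : ℝ) : ℂ) + star φ ⬝ᵥ u +
      star (Φᴴ *ᵥ φ) ⬝ᵥ f := by
    have : M *ᵥ φ = z • φ + (u + Φ *ᵥ f) := by
      rw [← h, Matrix.sub_mulVec, Matrix.smul_mulVec, Matrix.one_mulVec]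
      abel
    rw [this, dotProduct_add, dotProduct_add, dotProduct_smul, star_dotProduct_self_eq_sum,
      Matrix.star_mulVec, Matrix.conjTranspose_conjTranspose, Matrix.dotProduct_mulVec,
      smul_eq_mul, add_assoc]
  have h2 : (star φ ⬝ᵥ u).im = -(star u ⬝ᵥ φ).im := by
    rw [← Complex.conj_im, ← RCLike.star_def (K := ℂ), ← Matrix.star_dotProduct, dotProduct_comm,
      Matrix.dotProduct_star]
  have h3 := hM.im_star_dotProduct_mulVec_self φ
  rw [RCLike.im_eq_complex_im, h1, Complex.add_im, Complex.add_im, Complex.im_mul_ofReal, h2] at h3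
  linarith

theorem sum_norm_sq_eq_zero {V : Type*} [Fintype V] {φ : V → ℂ} (h : ∑ x, ‖φ x‖ ^ 2 ≤ 0) :
    φ = 0 := by
  funext x
  have h0 := (Finset.sum_eq_zero_iff_of_nonneg fun x _ => by positivity).1
    (le_antisymm h (Finset.sum_nonneg fun x _ => by positivity)) x (Finset.mem_univ x)
  simpa using h0

theorem isUnit_sub_smul_one {M : Matrix V V ℂ} (hM : M.IsHermitian) {z : ℂ} (hz : z.im ≠ 0) :
    IsUnit (M - z • 1) := by
  rw [← Matrix.mulVec_injective_iff_isUnit]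
  refine (injective_iff_map_eq_zero (Matrix.mulVecLin (M - z • 1))).2 fun φ h => ?_
  -- Green's formula without source and with an empty boundary forces `Im z ‖φ‖² = 0`.
  have h1 : (M - z • 1) *ᵥ φ = 0 + (0 : Matrix V (Fin 0) ℂ) *ᵥ 0 := by
    rw [Matrix.zero_mulVec, add_zero]
    exact h
  have := im_flux_eq hM h1
  simp only [dotProduct_zero, star_zero, zero_dotProduct, Complex.zero_im, zero_sub, zero_eq_neg,
    mul_eq_zero, hz, false_or] at this
  exact sum_norm_sq_eq_zero this.le

theorem mulVec_resolvent {M : Matrix V V ℂ} (hM : M.IsHermitian) {z : ℂ} (hz : z.im ≠ 0)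
    (g : V → ℂ) : (M - z • 1) *ᵥ ((M - z • 1)⁻¹ *ᵥ g) = g := by
  rw [Matrix.mulVec_mulVec, Matrix.mul_nonsing_inv _
    ((Matrix.isUnit_iff_isUnit_det _).1 (isUnit_sub_smul_one hM hz)), Matrix.one_mulVec]

theorem eq_resolvent_mulVec {M : Matrix V V ℂ} (hM : M.IsHermitian) {z : ℂ} (hz : z.im ≠ 0)
    {φ g : V → ℂ} (h : (M - z • 1) *ᵥ φ = g) : φ = (M - z • 1)⁻¹ *ᵥ g := by
  rw [← h, Matrix.mulVec_mulVec, Matrix.nonsing_inv_mul _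
    ((Matrix.isUnit_iff_isUnit_det _).1 (isUnit_sub_smul_one hM hz)), Matrix.one_mulVec]

theorem resolvent_conj {M : Matrix V V ℂ} (hM : M.IsHermitian) (z : ℂ) :
    (M - conj z • 1)⁻¹ = ((M - z • 1)⁻¹)ᴴ := by
  rw [Matrix.conjTranspose_nonsing_inv]
  congr 1
  simp [hM.eq]

theorem resolvent_normal {M : Matrix V V ℂ} (hM : M.IsHermitian) (z : ℂ) :
    (M - z • 1)⁻¹ * ((M - z • 1)⁻¹)ᴴ = ((M - z • 1)⁻¹)ᴴ * (M - z • 1)⁻¹ := by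
  rw [← resolvent_conj hM, ← Matrix.mul_inv_rev, ← Matrix.mul_inv_rev]
  congr 1
  simp only [Matrix.sub_mul, Matrix.mul_sub, Matrix.mul_smul, Matrix.smul_mul, mul_one, one_mul,
    smul_sub, smul_smul, mul_comm (conj z) z]
  abel

/-- The resolvent is normal and its adjoint is the resolvent at `conj z`. Hence one norm on the
boundary data serves both spectral parameters. -/
theorem sum_norm_sq_resolvent_conj {M : Matrix V V ℂ} (hM : M.IsHermitian) (z : ℂ) (g : V → ℂ) :
    ∑ x, ‖((M - conj z • 1)⁻¹ *ᵥ g) x‖ ^ 2 = ∑ x, ‖((M - z • 1)⁻¹ *ᵥ g) x‖ ^ 2 := by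
  have key : ∀ A : Matrix V V ℂ, ((∑ x, ‖(A *ᵥ g) x‖ ^ 2 : ℝ) : ℂ) = star g ⬝ᵥ (Aᴴ * A) *ᵥ g := by
    intro A
    rw [← star_dotProduct_self_eq_sum, Matrix.star_mulVec, ← Matrix.mulVec_mulVec,
      Matrix.dotProduct_mulVec (star g)]
  have : ((∑ x, ‖((M - conj z • 1)⁻¹ *ᵥ g) x‖ ^ 2 : ℝ) : ℂ) =
      ((∑ x, ‖((M - z • 1)⁻¹ *ᵥ g) x‖ ^ 2 : ℝ) : ℂ) := by
    rw [key, key, resolvent_conj hM, Matrix.conjTranspose_conjTranspose, resolvent_normal hM]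
  exact_mod_cast this

/-- The Weyl set of a finite Hermitian matrix `M` with root vector `u` and boundary modes `Φ`,
described by the solutions of the boundary value problem `(M - z) φ ∈ u + ran Φ`. -/
def finiteWeylSet (M : Matrix V V ℂ) (u : V → ℂ) (Φ : Matrix V ι ℂ) (z : ℂ) : Set ℂ :=
  {w | ∃ (φ : V → ℂ) (f : ι → ℂ), (M - z • 1) *ᵥ φ = u + Φ *ᵥ f ∧ star u ⬝ᵥ φ = w ∧
    z.im ^ 2 * ∑ x, ‖φ x‖ ^ 2 ≤ z.im * w.im}

/-- Split the solution into the parts driven by `u` and by `Φ f`, and apply Green's formula without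
source to the latter. The flux becomes an explicit quadratic function of `f`. -/
theorem im_flux_resolvent {M : Matrix V V ℂ} (hM : M.IsHermitian) {z : ℂ} (hz : z.im ≠ 0)
    (u : V → ℂ) (Φ : Matrix V ι ℂ) (f : ι → ℂ) :
    (star (Φᴴ *ᵥ ((M - z • 1)⁻¹ *ᵥ (u + Φ *ᵥ f))) ⬝ᵥ f).im =
      (star (Φᴴ *ᵥ ((M - z • 1)⁻¹ *ᵥ u)) ⬝ᵥ f).im -
        z.im * ∑ x, ‖((M - z • 1)⁻¹ *ᵥ (Φ *ᵥ f)) x‖ ^ 2 := by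
  have h : (M - z • 1) *ᵥ ((M - z • 1)⁻¹ *ᵥ (Φ *ᵥ f)) = 0 + Φ *ᵥ f := by
    rw [mulVec_resolvent hM hz, zero_add]
  have := im_flux_eq hM h
  rw [Matrix.mulVec_add, Matrix.mulVec_add, star_add, add_dotProduct, Complex.add_im, this]
  simp [sub_eq_add_neg]

theorem mem_finiteWeylSet_iff {M : Matrix V V ℂ} (hM : M.IsHermitian) {z : ℂ} (hz : z.im ≠ 0)
    (u : V → ℂ) (Φ : Matrix V ι ℂ) (w : ℂ) :
    w ∈ finiteWeylSet M u Φ z ↔ ∃ f : ι → ℂ,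
      w = star u ⬝ᵥ (M - z • 1)⁻¹ *ᵥ u + star u ⬝ᵥ (M - z • 1)⁻¹ *ᵥ (Φ *ᵥ f) ∧
        z.im ^ 2 * ∑ x, ‖((M - z • 1)⁻¹ *ᵥ (Φ *ᵥ f)) x‖ ^ 2 ≤
          z.im * (star (Φᴴ *ᵥ ((M - z • 1)⁻¹ *ᵥ u)) ⬝ᵥ f).im := by
  constructor
  · rintro ⟨φ, f, h, rfl, hle⟩
    have h1 := im_flux_eq hM h
    have hφ := eq_resolvent_mulVec hM hz h
    have h2 := im_flux_resolvent hM hz u Φ f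
    rw [← hφ, h1] at h2
    refine ⟨f, ?_, ?_⟩
    · rw [← dotProduct_add, ← Matrix.mulVec_add, ← hφ]
    · have := congrArg (z.im * ·) h2
      simp only [mul_sub] at this
      nlinarith
  · rintro ⟨f, rfl, hle⟩
    have h := mulVec_resolvent hM hz (u + Φ *ᵥ f)
    have h1 := im_flux_eq hM h
    have h2 := im_flux_resolvent hM hz u Φ f
    refine ⟨_, f, h, ?_, ?_⟩
    · rw [← dotProduct_add, ← Matrix.mulVec_add]
    · rw [← dotProduct_add, ← Matrix.mulVec_add]
      rw [h1] at h2
      have := congrArg (z.im * ·) h2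
      simp only [mul_sub] at this
      nlinarith

open scoped ComplexOrder in
theorem im_star_dotProduct_mulVec_nonneg {A : Matrix ι ι ℂ}
    (hA : ((2 * Complex.I)⁻¹ • (A - Aᴴ)).PosSemidef) (v : ι → ℂ) : 0 ≤ (star v ⬝ᵥ A *ᵥ v).im := by
  have h := (Complex.le_def.1 (hA.dotProduct_mulVec_nonneg v)).1
  have h1 : star v ⬝ᵥ Aᴴ *ᵥ v = conj (star v ⬝ᵥ A *ᵥ v) := by
    rw [Matrix.dotProduct_mulVec, ← Matrix.star_mulVec, ← RCLike.star_def (K := ℂ),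
      ← Matrix.star_dotProduct_star, star_star]
  rw [Matrix.smul_mulVec, Matrix.sub_mulVec, dotProduct_smul, dotProduct_sub, h1,
    Complex.sub_conj, smul_eq_mul] at h
  have e : (2 * Complex.I)⁻¹ * (((2 * (star v ⬝ᵥ A *ᵥ v).im : ℝ) : ℂ) * Complex.I) =
      (((star v ⬝ᵥ A *ᵥ v).im : ℝ) : ℂ) := by
    have := Complex.I_ne_zero
    push_cast
    field_simp
  rw [e] at h
  simpa using h

open scoped ComplexOrder in
theorem posSemidef_im_smul_vecMulVec (c : ℂ) (hc : 0 ≤ c.im) (f : ι → ℂ) :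
    ((2 * Complex.I)⁻¹ • (c • Matrix.vecMulVec f (star f) -
      (c • Matrix.vecMulVec f (star f))ᴴ)).PosSemidef := by
  have h : (2 * Complex.I)⁻¹ • (c • Matrix.vecMulVec f (star f) -
      (c • Matrix.vecMulVec f (star f))ᴴ) = (c.im : ℂ) • Matrix.vecMulVec f (star f) := by
    rw [Matrix.conjTranspose_smul, Matrix.conjTranspose_vecMulVec, star_star, ← sub_smul,
      RCLike.star_def, Complex.sub_conj, smul_smul]
    congr 1
    have := Complex.I_ne_zero
    push_cast
    field_simp
  rw [h]
  exact (Matrix.posSemidef_vecMulVec_self_star f).smul (by exact_mod_cast hc)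

variable [DecidableEq ι]

open scoped ComplexOrder in
-- A kernel vector would give a source-free solution whose flux is non-negative because `Im A ≥ 0`,
-- yet equals `-Im z ‖φ‖²`; so it vanishes.
theorem isUnit_one_sub_mul {M : Matrix V V ℂ} (hM : M.IsHermitian) {z : ℂ} (hz : 0 < z.im)
    (Φ : Matrix V ι ℂ) {A : Matrix ι ι ℂ} (hA : ((2 * Complex.I)⁻¹ • (A - Aᴴ)).PosSemidef) :
    IsUnit (1 - Φᴴ * (M - z • 1)⁻¹ * Φ * A) := by
  rw [← Matrix.mulVec_injective_iff_isUnit]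
  refine (injective_iff_map_eq_zero (Matrix.mulVecLin _)).2 fun v h => ?_
  have hv : Φᴴ *ᵥ ((M - z • 1)⁻¹ *ᵥ (Φ *ᵥ (A *ᵥ v))) = v := by
    rw [Matrix.mulVecLin_apply, Matrix.sub_mulVec, Matrix.one_mulVec, sub_eq_zero] at h
    simpa only [Matrix.mulVec_mulVec, Matrix.mul_assoc] using h.symm
  have h1 := im_flux_resolvent hM hz.ne' 0 Φ (A *ᵥ v)
  rw [zero_add, hv] at h1
  have h2 := im_star_dotProduct_mulVec_nonneg hA v
  simp only [Matrix.mulVec_zero, star_zero, zero_dotProduct, Complex.zero_im, zero_sub] at h1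
  rw [h1] at h2
  have h3 := sum_norm_sq_eq_zero (φ := (M - z • 1)⁻¹ *ᵥ (Φ *ᵥ (A *ᵥ v))) (by nlinarith)
  rw [← hv, h3, Matrix.mulVec_zero]

open scoped ComplexOrder in
/-- The values of the linear fractional transformation on the matrices with non-negative imaginary
part. -/
def moebiusSet (M : Matrix V V ℂ) (u : V → ℂ) (Φ : Matrix V ι ℂ) (z : ℂ) : Set ℂ :=
  {w | ∃ A : Matrix ι ι ℂ, ((2 * Complex.I)⁻¹ • (A - Aᴴ)).PosSemidef ∧
    w = star u ⬝ᵥ (M - z • 1)⁻¹ *ᵥ u + star u ⬝ᵥ (M - z • 1)⁻¹ *ᵥ (Φ *ᵥ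
      (A *ᵥ ((1 - Φᴴ * (M - z • 1)⁻¹ * Φ * A)⁻¹ *ᵥ (Φᴴ *ᵥ ((M - z • 1)⁻¹ *ᵥ u)))))}

/-- The vector `g` below is the boundary value `Φ^* φ` of the solution with `f = A g`, so its flux
is `Im ⟨g, A g⟩ ≥ 0`. -/
theorem moebiusSet_subset {M : Matrix V V ℂ} (hM : M.IsHermitian) {z : ℂ} (hz : 0 < z.im)
    (u : V → ℂ) (Φ : Matrix V ι ℂ) : moebiusSet M u Φ z ⊆ finiteWeylSet M u Φ z := by
  rintro w ⟨A, hA, rfl⟩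
  rw [mem_finiteWeylSet_iff hM hz.ne']
  have hU := (Matrix.isUnit_iff_isUnit_det _).1 (isUnit_one_sub_mul hM hz Φ hA)
  set g := (1 - Φᴴ * (M - z • 1)⁻¹ * Φ * A)⁻¹ *ᵥ (Φᴴ *ᵥ ((M - z • 1)⁻¹ *ᵥ u)) with hg
  have h1 : Φᴴ *ᵥ ((M - z • 1)⁻¹ *ᵥ (u + Φ *ᵥ (A *ᵥ g))) = g := by
    have : (1 - Φᴴ * (M - z • 1)⁻¹ * Φ * A) *ᵥ g = Φᴴ *ᵥ ((M - z • 1)⁻¹ *ᵥ u) := by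
      rw [hg, Matrix.mulVec_mulVec, Matrix.mul_nonsing_inv _ hU, Matrix.one_mulVec]
    rw [Matrix.mulVec_add, Matrix.mulVec_add, ← this, Matrix.sub_mulVec, Matrix.one_mulVec]
    simp only [Matrix.mulVec_mulVec, Matrix.mul_assoc, sub_add_cancel]
  refine ⟨A *ᵥ g, rfl, ?_⟩
  have h2 := im_flux_resolvent hM hz.ne' u Φ (A *ᵥ g)
  rw [h1] at h2
  have h3 := im_star_dotProduct_mulVec_nonneg hA g
  nlinarith

open scoped ComplexOrder in
-- With `g = Φ^* φ`, the matrix `A = f f^* / ⟨f, g⟩` sends `g` to `f`, and positive flux makes both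
-- the denominator non-zero and `Im A ≥ 0`. At zero flux the denominator may vanish, hence the
-- strict inequality and the separate case `f = 0`.
theorem mem_moebiusSet {M : Matrix V V ℂ} (hM : M.IsHermitian) {z : ℂ} (hz : 0 < z.im)
    (u : V → ℂ) (Φ : Matrix V ι ℂ) (f : ι → ℂ)
    (hf : f = 0 ∨ z.im ^ 2 * ∑ x, ‖((M - z • 1)⁻¹ *ᵥ (Φ *ᵥ f)) x‖ ^ 2 <
      z.im * (star (Φᴴ *ᵥ ((M - z • 1)⁻¹ *ᵥ u)) ⬝ᵥ f).im) :
    star u ⬝ᵥ (M - z • 1)⁻¹ *ᵥ u + star u ⬝ᵥ (M - z • 1)⁻¹ *ᵥ (Φ *ᵥ f) ∈ moebiusSet M u Φ z := by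
  rcases hf with rfl | hf
  · exact ⟨0, by simpa using Matrix.PosSemidef.zero, by simp⟩
  set g := Φᴴ *ᵥ ((M - z • 1)⁻¹ *ᵥ (u + Φ *ᵥ f)) with hg
  have h2 := im_flux_resolvent hM hz.ne' u Φ f
  rw [← hg] at h2
  have hpos : 0 < (star g ⬝ᵥ f).im := by
    rw [h2]
    nlinarith
  have hs : star f ⬝ᵥ g = conj (star g ⬝ᵥ f) := by
    rw [← RCLike.star_def (K := ℂ), ← Matrix.star_dotProduct_star, star_star]
  have hs0 : star f ⬝ᵥ g ≠ 0 := by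
    rw [hs]
    intro h0
    rw [map_eq_zero] at h0
    simp [h0] at hpos
  have hc : 0 ≤ ((star f ⬝ᵥ g)⁻¹).im := by
    rw [Complex.inv_im, hs, Complex.conj_im, neg_neg]
    exact div_nonneg hpos.le (Complex.normSq_nonneg _)
  have hA := posSemidef_im_smul_vecMulVec _ hc f
  refine ⟨_, hA, ?_⟩
  set A := (star f ⬝ᵥ g)⁻¹ • Matrix.vecMulVec f (star f) with hAdef
  have hAg : A *ᵥ g = f := by
    rw [hAdef, Matrix.smul_mulVec, Matrix.vecMulVec_mulVec]
    ext i
    simp [hs0]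
  have hU := (Matrix.isUnit_iff_isUnit_det _).1 (isUnit_one_sub_mul hM hz Φ hA)
  have h3 : (1 - Φᴴ * (M - z • 1)⁻¹ * Φ * A) *ᵥ g = Φᴴ *ᵥ ((M - z • 1)⁻¹ *ᵥ u) := by
    rw [Matrix.sub_mulVec, Matrix.one_mulVec, ← Matrix.mulVec_mulVec, hAg, hg, Matrix.mulVec_add,
      Matrix.mulVec_add]
    simp only [Matrix.mulVec_mulVec, Matrix.mul_assoc, add_sub_cancel_right]
  rw [← h3, Matrix.mulVec_mulVec g (1 - Φᴴ * (M - z • 1)⁻¹ * Φ * A)⁻¹, Matrix.nonsing_inv_mul _ hU, Matrix.one_mulVec, hAg]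

end FiniteWeyl

/-! ### The finite Weyl set is a disc. -/

section FiniteWeylDisc

variable {V ι : Type*} [Fintype V] [DecidableEq V] [Fintype ι] [DecidableEq ι]

theorem exists_inner_eq {F : Type*} [NormedAddCommGroup F] [InnerProductSpace ℂ F]
    [FiniteDimensional ℂ F] (l : F →ₗ[ℂ] ℂ) : ∃ a : F, ∀ e, inner ℂ a e = l e := by
  have := FiniteDimensional.complete ℂ F
  refine ⟨(InnerProductSpace.toDual ℂ F).symm (LinearMap.toContinuousLinearMap l), fun e => ?_⟩
  rw [InnerProductSpace.toDual_symm_apply]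
  rfl

/-- The solutions of `(M - z) φ ∈ ran Φ` form a space isomorphic to the space of boundary data. -/
theorem exists_linearEquiv_solutions {ι : Type*} [Fintype ι] {M : Matrix V V ℂ}
    (hM : M.IsHermitian) {z : ℂ} (hz : z.im ≠ 0) {Φ : Matrix V ι ℂ}
    (hΦ : Function.Injective Φ.mulVec) :
    ∃ (F : Submodule ℂ (EuclideanSpace ℂ V)) (T : (ι → ℂ) ≃ₗ[ℂ] F),
      ∀ f, ‖T f‖ ^ 2 = ∑ x, ‖((M - z • 1)⁻¹ *ᵥ (Φ *ᵥ f)) x‖ ^ 2 := by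
  let S : (ι → ℂ) →ₗ[ℂ] EuclideanSpace ℂ V :=
    (WithLp.linearEquiv 2 ℂ (V → ℂ)).symm.toLinearMap ∘ₗ
      (Matrix.mulVecLin (M - z • 1)⁻¹ ∘ₗ Matrix.mulVecLin Φ)
  have hS : Function.Injective S := by
    intro f g hfg
    apply hΦ
    have h1 : (M - z • 1)⁻¹ *ᵥ (Φ *ᵥ f) = (M - z • 1)⁻¹ *ᵥ (Φ *ᵥ g) :=
      (WithLp.linearEquiv 2 ℂ (V → ℂ)).symm.injective hfg
    rw [← mulVec_resolvent hM hz (Φ *ᵥ f), h1, mulVec_resolvent hM hz]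
  exact ⟨LinearMap.range S, LinearEquiv.ofInjective S hS,
    fun f => EuclideanSpace.norm_sq_eq (S f)⟩

theorem star_dotProduct_resolvent_conj {ι : Type*} [Fintype ι] {M : Matrix V V ℂ}
    (hM : M.IsHermitian) (z : ℂ) (u : V → ℂ) (Φ : Matrix V ι ℂ) (f : ι → ℂ) :
    star u ⬝ᵥ (M - conj z • 1)⁻¹ *ᵥ (Φ *ᵥ f) =
      star (Φᴴ *ᵥ ((M - z • 1)⁻¹ *ᵥ u)) ⬝ᵥ f := by
  rw [resolvent_conj hM, Matrix.star_mulVec, Matrix.conjTranspose_conjTranspose,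
    Matrix.star_mulVec, ← Matrix.dotProduct_mulVec, ← Matrix.dotProduct_mulVec]

/-- The space `F` carries the boundary data with the norm of `(M - z)⁻¹ Φ f`. Everything is stated
for the same centre and radius; the last inequality is Cauchy–Schwarz for the two functionals whose
norms make up the radius. -/
theorem finiteWeylSet_disc_of_linearEquiv {F : Type*} [NormedAddCommGroup F]
    [InnerProductSpace ℂ F] [FiniteDimensional ℂ F] {M : Matrix V V ℂ} (hM : M.IsHermitian) {z : ℂ}
    (hz : 0 < z.im) (u : V → ℂ) {Φ : Matrix V ι ℂ} (T : (ι → ℂ) ≃ₗ[ℂ] F)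
    (hT : ∀ f, ‖T f‖ ^ 2 = ∑ x, ‖((M - z • 1)⁻¹ *ᵥ (Φ *ᵥ f)) x‖ ^ 2) :
    ∃ (c : ℂ) (ρ : ℝ), 0 ≤ ρ ∧ closure (moebiusSet M u Φ z) = Metric.closedBall c ρ ∧
      finiteWeylSet M u Φ z = Metric.closedBall c ρ ∧
      finiteWeylSet M u Φ (conj z) = Metric.closedBall (conj c) ρ ∧
      (0 < ρ ↔ (∃ f, star u ⬝ᵥ (M - z • 1)⁻¹ *ᵥ (Φ *ᵥ f) ≠ 0) ∧
        ∃ f, star u ⬝ᵥ (M - conj z • 1)⁻¹ *ᵥ (Φ *ᵥ f) ≠ 0) ∧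
      ∀ f g, ‖star u ⬝ᵥ (M - z • 1)⁻¹ *ᵥ (Φ *ᵥ f)‖ *
          ‖star u ⬝ᵥ (M - conj z • 1)⁻¹ *ᵥ (Φ *ᵥ g)‖ ≤
        2 * z.im * ρ * (√(∑ x, ‖((M - z • 1)⁻¹ *ᵥ (Φ *ᵥ f)) x‖ ^ 2) *
          √(∑ x, ‖((M - conj z • 1)⁻¹ *ᵥ (Φ *ᵥ g)) x‖ ^ 2)) := by
  obtain ⟨a, ha⟩ := exists_inner_eq (dotProductBilin ℂ ℂ (star u) ∘ₗ
    Matrix.mulVecLin (M - z • 1)⁻¹ ∘ₗ Matrix.mulVecLin Φ ∘ₗ T.symm.toLinearMap)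
  replace ha : ∀ f, inner ℂ a (T f) = star u ⬝ᵥ (M - z • 1)⁻¹ *ᵥ (Φ *ᵥ f) := fun f => by
    rw [ha]
    simp
  obtain ⟨b, hb⟩ := exists_inner_eq (dotProductBilin ℂ ℂ (star (Φᴴ *ᵥ ((M - z • 1)⁻¹ *ᵥ u))) ∘ₗ
    T.symm.toLinearMap)
  replace hb : ∀ f, inner ℂ b (T f) = star (Φᴴ *ᵥ ((M - z • 1)⁻¹ *ᵥ u)) ⬝ᵥ f := fun f => by
    rw [hb]
    simp
  have hb' : ∀ f, inner ℂ b (T f) = star u ⬝ᵥ (M - conj z • 1)⁻¹ *ᵥ (Φ *ᵥ f) := fun f => by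
    rw [hb, star_dotProduct_resolvent_conj hM]
  have ha' : ∀ f, inner ℂ a (T f) = star (Φᴴ *ᵥ ((M - conj z • 1)⁻¹ *ᵥ u)) ⬝ᵥ f := fun f => by
    rw [ha, ← star_dotProduct_resolvent_conj hM, Complex.conj_conj]
  have hzc : (conj z).im ≠ 0 := by simpa using hz.ne'
  set α := star u ⬝ᵥ (M - z • 1)⁻¹ *ᵥ u with hα
  have hα' : star u ⬝ᵥ (M - conj z • 1)⁻¹ *ᵥ u = conj α := by
    rw [hα, resolvent_conj hM, Matrix.dotProduct_mulVec, ← Matrix.star_mulVec,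
      ← RCLike.star_def (K := ℂ), ← Matrix.star_dotProduct_star, star_star]
  have h1 : finiteWeylSet M u Φ z =
      {w | ∃ e : F, w = α + inner ℂ a e ∧ z.im ^ 2 * ‖e‖ ^ 2 ≤ z.im * (inner ℂ b e).im} := by
    ext w
    rw [mem_finiteWeylSet_iff hM hz.ne', Set.mem_ofPred_eq, T.surjective.exists]
    simp only [ha, hb, hT, hα]
  -- Passing to `conj z` swaps `a` with `b` and changes the sign of `t`; the radius is invariant.
  have h2 : finiteWeylSet M u Φ (conj z) = {w | ∃ e : F, w = conj α + inner ℂ b e ∧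
      (-z.im) ^ 2 * ‖e‖ ^ 2 ≤ -z.im * (inner ℂ a e).im} := by
    ext w
    rw [mem_finiteWeylSet_iff hM hzc, Set.mem_ofPred_eq, T.surjective.exists]
    simp only [ha', hb', hT, ← hα', sum_norm_sq_resolvent_conj hM, Complex.conj_im]
  have h3 : closure (moebiusSet M u Φ z) = finiteWeylSet M u Φ z := by
    apply subset_antisymm
    · refine closure_minimal (moebiusSet_subset hM hz u Φ) ?_
      rw [h1, image_ellipsoid _ _ _ hz.ne']
      exact Metric.isClosed_closedBall
    · rw [h1]
      refine (subset_closure_image_ellipsoid_interior _ _ _ hz.ne').trans (closure_mono ?_)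
      rintro w ⟨e, rfl, he⟩
      obtain ⟨f, rfl⟩ := T.surjective e
      rw [ha]
      refine mem_moebiusSet hM hz u Φ f ?_
      rwa [LinearEquiv.map_eq_zero_iff, hT, hb] at he
  have h4 := image_ellipsoid α a b hz.ne'
  refine ⟨α + Complex.I * inner ℂ a b / (2 * z.im), ‖a‖ * ‖b‖ / (2 * |z.im|), by positivity,
    ?_, ?_, ?_, ?_, ?_⟩
  · rw [h3, h1, h4]
  · rw [h1, h4]
  · rw [h2, image_ellipsoid _ _ _ (neg_ne_zero.2 hz.ne')]
    congr 1
    · rw [map_add, map_div₀, map_mul, inner_conj_symm, map_mul, map_ofNat, Complex.conj_I,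
        Complex.conj_ofReal, Complex.ofReal_neg]
      ring
    · rw [abs_neg, mul_comm ‖a‖]
  · have key : ∀ v : F, v ≠ 0 ↔ ∃ f, inner ℂ v (T f) ≠ 0 := by
      intro v
      rw [← not_iff_not]
      push Not
      constructor
      · rintro rfl f
        exact inner_zero_left _
      · intro h
        obtain ⟨f, hf⟩ := T.surjective v
        have := h f
        rwa [hf, inner_self_eq_zero] at this
    simp only [← ha, ← hb', ← key]
    rw [abs_of_pos hz]
    constructor
    · intro h
      refine ⟨?_, ?_⟩ <;> rintro rfl <;> simp at h
    · rintro ⟨h, h'⟩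
      have := norm_pos_iff.2 h
      have := norm_pos_iff.2 h'
      positivity
  · intro f g
    rw [sum_norm_sq_resolvent_conj hM, ← ha, ← hb', ← hT, ← hT, Real.sqrt_sq (norm_nonneg _),
      Real.sqrt_sq (norm_nonneg _), abs_of_pos hz]
    calc _ ≤ (‖a‖ * ‖T f‖) * (‖b‖ * ‖T g‖) := by
          gcongr <;> exact norm_inner_le_norm _ _
      _ = _ := by field_simp

theorem finiteWeylSet_disc {M : Matrix V V ℂ} (hM : M.IsHermitian) {z : ℂ} (hz : 0 < z.im)
    (u : V → ℂ) {Φ : Matrix V ι ℂ} (hΦ : Function.Injective Φ.mulVec) :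
    ∃ (c : ℂ) (ρ : ℝ), 0 ≤ ρ ∧ closure (moebiusSet M u Φ z) = Metric.closedBall c ρ ∧
      finiteWeylSet M u Φ z = Metric.closedBall c ρ ∧
      finiteWeylSet M u Φ (conj z) = Metric.closedBall (conj c) ρ ∧
      (0 < ρ ↔ (∃ f, star u ⬝ᵥ (M - z • 1)⁻¹ *ᵥ (Φ *ᵥ f) ≠ 0) ∧
        ∃ f, star u ⬝ᵥ (M - conj z • 1)⁻¹ *ᵥ (Φ *ᵥ f) ≠ 0) ∧
      ∀ f g, ‖star u ⬝ᵥ (M - z • 1)⁻¹ *ᵥ (Φ *ᵥ f)‖ *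
          ‖star u ⬝ᵥ (M - conj z • 1)⁻¹ *ᵥ (Φ *ᵥ g)‖ ≤
        2 * z.im * ρ * (√(∑ x, ‖((M - z • 1)⁻¹ *ᵥ (Φ *ᵥ f)) x‖ ^ 2) *
          √(∑ x, ‖((M - conj z • 1)⁻¹ *ᵥ (Φ *ᵥ g)) x‖ ^ 2)) := by
  obtain ⟨F, T, hT⟩ := exists_linearEquiv_solutions hM hz.ne' hΦ
  exact finiteWeylSet_disc_of_linearEquiv (F := F) hM hz u T hT

end FiniteWeylDisc

/-! ### Weyl sets of the first shells. -/

theorem Matrix.mulVec_injective_of_rank_eq_card {V ι : Type*} [Fintype ι]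
    {A : Matrix V ι ℂ} (h : A.rank = Fintype.card ι) : Function.Injective A.mulVec := by
  have h1 := LinearMap.finrank_range_add_finrank_ker A.mulVecLin
  rw [Module.finrank_fintype_fun_eq_card] at h1
  have h2 : Module.finrank ℂ (LinearMap.ker A.mulVecLin) = 0 := by
    have : Module.finrank ℂ (LinearMap.range A.mulVecLin) = Fintype.card ι := h
    omega
  rw [Submodule.finrank_eq_zero] at h2
  exact LinearMap.ker_eq_bot.1 h2

theorem Matrix.rank_eq_zero_iff_mulVec {V ι : Type*} [Fintype ι] {A : Matrix V ι ℂ} :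
    A.rank = 0 ↔ ∀ f, A *ᵥ f = 0 := by
  rw [Matrix.rank, Submodule.finrank_eq_zero, LinearMap.range_eq_bot, LinearMap.ext_iff]
  rfl

theorem Matrix.conjTranspose_mul_mul_apply {V κ : Type*} [Fintype V] (U : Matrix V κ ℂ)
    (B : Matrix V V ℂ) (i : κ) :
    (Uᴴ * B * U) i i = star (fun x => U x i) ⬝ᵥ B *ᵥ (fun x => U x i) := by
  rw [Matrix.mul_assoc, Matrix.mul_apply]
  simp only [dotProduct, Matrix.mulVec, Matrix.mul_apply, Matrix.conjTranspose_apply, Pi.star_apply]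

theorem HoppingOperator.formal_eq_sum {G : Type*} (H : HoppingOperator G) (φ : G → ℂ) (x : G)
    (s : Finset G) (hs : ∀ y, H.entry x y ≠ 0 → φ y ≠ 0 → y ∈ s) :
    H.formal φ x = ∑ y ∈ s, H.entry x y * φ y := by
  classical
  have h : H.formal φ x = ∑ y ∈ (H.locallyFinite x).toFinset, H.entry x y * φ y := rfl
  rw [h, Finset.sum_subset (Finset.subset_union_left (s₂ := s)),
    ← Finset.sum_subset (Finset.subset_union_right (s₁ := (H.locallyFinite x).toFinset))]
  · intro y _ hy
    by_contra h0
    exact hy (hs y (left_ne_zero_of_mul h0) (right_ne_zero_of_mul h0))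
  · intro y _ hy
    have : H.entry x y = 0 := by simpa using hy
    rw [this, zero_mul]

namespace QuasiSphericalPartition

variable {G : Type*} {H : HoppingOperator G} (Q : QuasiSphericalPartition H)

theorem isHermitian_Hpart (m n : ℕ) : (Q.Hpart m n).IsHermitian := by
  ext x y
  exact (H.symmetric x y).symm

theorem eq_rootIndex (i : Fin (Q.r 0)) : i = Q.rootIndex := by
  apply Fin.ext
  have := i.2
  have := Q.r_zero
  change (i : ℕ) = 0
  omega

/-- The restriction of the root vector to the first shells. -/
def rootVec (n : ℕ) : Q.Slab 0 n → ℂ := fun x => Q.ΥEmb 0 n x Q.rootIndex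

theorem rootVec_apply (n : ℕ) (x : Q.Slab 0 n) : Q.rootVec n x = (Q.root : G → ℂ) x := rfl

theorem ΦEmb_mulVec_of_eq {m n : ℕ} (f : Fin (Q.r (n + 1)) → ℂ) (x : Q.Slab m n)
    (h : Q.shell x = n) : (Q.ΦEmb m n *ᵥ f) x = (Q.Φ n *ᵥ f) ⟨x, h⟩ := by
  simp [Matrix.mulVec, dotProduct, ΦEmb, h]

theorem ΦEmb_mulVec_of_ne {m n : ℕ} (f : Fin (Q.r (n + 1)) → ℂ) (x : Q.Slab m n)
    (h : Q.shell x ≠ n) : (Q.ΦEmb m n *ᵥ f) x = 0 := by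
  simp [Matrix.mulVec, dotProduct, ΦEmb, h]

theorem ΦEmb_injective (n : ℕ) : Function.Injective (Q.ΦEmb 0 n).mulVec := by
  intro f g hfg
  apply Matrix.mulVec_injective_of_rank_eq_card
    (A := Q.Φ n) ((Q.rank_Φ n).trans (Fintype.card_fin _).symm)
  funext x
  have h := congrFun hfg ⟨x, Nat.zero_le _, x.2.le⟩
  rwa [Q.ΦEmb_mulVec_of_eq f _ x.2, Q.ΦEmb_mulVec_of_eq g _ x.2] at h

theorem R_eq_fromBlocks {m n : ℕ} {z : ℂ} (hz : z.im ≠ 0) :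
    Q.R m n z = Matrix.fromBlocks
      ((Q.ΥEmb m n)ᴴ * (Q.Hpart m n - z • 1)⁻¹ * Q.ΥEmb m n)
      ((Q.ΥEmb m n)ᴴ * (Q.Hpart m n - z • 1)⁻¹ * Q.ΦEmb m n)
      ((Q.ΦEmb m n)ᴴ * (Q.Hpart m n - z • 1)⁻¹ * Q.ΥEmb m n)
      ((Q.ΦEmb m n)ᴴ * (Q.Hpart m n - z • 1)⁻¹ * Q.ΦEmb m n) := by
  rw [R, if_pos (isUnit_sub_smul_one (Q.isHermitian_Hpart m n) hz), resolventData,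
    Matrix.conjTranspose_fromCols_eq_fromRows_conjTranspose, Matrix.fromRows_mul,
    Matrix.fromRows_mul_fromCols]

/-- Points without analytic extension are real by definition, and `r 0 = 1`, so for non-real `z`
only the vanishing of the row `β` is left. -/
theorem mem_ASet_iff {n : ℕ} {z : ℂ} (hz : z.im ≠ 0) :
    z ∈ Q.ASet 0 n ↔ ¬ ∃ f, star (Q.rootVec n) ⬝ᵥ (Q.Hpart 0 n - z • 1)⁻¹ *ᵥ
      (Q.ΦEmb 0 n *ᵥ f) ≠ 0 := by
  have hβ : ∀ f, (Q.β 0 n z *ᵥ f) Q.rootIndex =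
      star (Q.rootVec n) ⬝ᵥ (Q.Hpart 0 n - z • 1)⁻¹ *ᵥ (Q.ΦEmb 0 n *ᵥ f) := by
    intro f
    rw [β, Q.R_eq_fromBlocks hz, Matrix.toBlocks_fromBlocks₁₂, ← Matrix.mulVec_mulVec,
      ← Matrix.mulVec_mulVec]
    rfl
  have h1 : z ∉ Q.A1Set 0 n := fun h => hz h.1
  have h2 : ∀ k, k < Q.r 0 ↔ k = 0 := fun k => by rw [Q.r_zero, Nat.lt_one_iff]
  rw [ASet, Set.mem_union, or_iff_right h1, A2Set, Set.mem_ofPred_eq, h2,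
    Matrix.rank_eq_zero_iff_mulVec]
  push Not
  refine forall_congr' fun f => ?_
  rw [← hβ]
  refine ⟨fun h => congrFun h _, fun h => ?_⟩
  funext i
  rw [Q.eq_rootIndex i, h]
  rfl

/-- The solutions of the boundary value problem on the first shells define the Weyl disc. -/
def weylSet (n : ℕ) (z : ℂ) : Set ℂ :=
  finiteWeylSet (Q.Hpart 0 n) (Q.rootVec n) (Q.ΦEmb 0 n) z

theorem weylDisc_eq_closure_moebiusSet (n : ℕ) {z : ℂ} (hz : z.im ≠ 0) :
    Q.weylDisc n z = closure (moebiusSet (Q.Hpart 0 n) (Q.rootVec n) (Q.ΦEmb 0 n) z) := by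
  rw [weylDisc, moebiusSet]
  congr 2
  ext w
  refine exists_congr fun A => and_congr_right fun _ => ?_
  rw [α, β, γ, δ, Q.R_eq_fromBlocks hz, Matrix.toBlocks_fromBlocks₁₁,
    Matrix.toBlocks_fromBlocks₁₂, Matrix.toBlocks_fromBlocks₂₁, Matrix.toBlocks_fromBlocks₂₂,
    Matrix.add_apply, Matrix.conjTranspose_mul_mul_apply]
  set Gz := (Q.Hpart 0 n - z • 1)⁻¹
  set B := (1 - (Q.ΦEmb 0 n)ᴴ * Gz * Q.ΦEmb 0 n * A)⁻¹
  have h : (Q.ΥEmb 0 n)ᴴ * Gz * Q.ΦEmb 0 n * (A * B) * ((Q.ΦEmb 0 n)ᴴ * Gz * Q.ΥEmb 0 n) =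
      (Q.ΥEmb 0 n)ᴴ * (Gz * (Q.ΦEmb 0 n * (A * (B * ((Q.ΦEmb 0 n)ᴴ * Gz))))) * Q.ΥEmb 0 n := by
    simp only [Matrix.mul_assoc]
  rw [h, Matrix.conjTranspose_mul_mul_apply]
  simp only [← Matrix.mulVec_mulVec]
  rfl

theorem finite_shell_le (n : ℕ) : {x | Q.shell x ≤ n}.Finite :=
  ((Set.finite_Iic n).biUnion fun k _ => Q.shell_finite k).subset fun x hx =>
    Set.mem_biUnion (x := Q.shell x) hx rfl

theorem sum_slab_eq_sum {n : ℕ} (F : G → ℂ) (s : Finset G)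
    (hs : ∀ x, x ∈ s ↔ Q.shell x ≤ n) : ∑ x : Q.Slab 0 n, F x = ∑ x ∈ s, F x := by
  refine (Finset.sum_subtype s (fun x => ?_) F).symm
  simp [hs]

/-- The pairing with the root vector, for arbitrary functions on `G`. -/
noncomputable def rootPairing (φ : G → ℂ) : ℂ :=
  ∑ x ∈ (Q.shell_finite 0).toFinset, conj ((Q.root : G → ℂ) x) * φ x

theorem root_apply_of_ne {x : G} (h : Q.shell x ≠ 0) : (Q.root : G → ℂ) x = 0 := dif_neg h

theorem exists_root_ne_zero : ∃ x, Q.shell x = 0 ∧ (Q.root : G → ℂ) x ≠ 0 := by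
  by_contra! h
  have h0 : Q.Υ 0 *ᵥ (fun _ => 1) = Q.Υ 0 *ᵥ 0 := by
    funext x
    have hx := h x x.2
    have h1 : (Q.root : G → ℂ) x = Q.Υ 0 x Q.rootIndex := dif_pos x.2
    rw [h1] at hx
    simp only [Matrix.mulVec, dotProduct, mul_one, Pi.zero_apply, mul_zero, Finset.sum_const_zero]
    refine Finset.sum_eq_zero fun i _ => ?_
    rw [Q.eq_rootIndex i, hx]
  have := congrFun (Matrix.mulVec_injective_of_rank_eq_card
    ((Q.rank_Υ 0).trans (Fintype.card_fin _).symm) h0) Q.rootIndex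
  simp at this

theorem star_rootVec_dotProduct (n : ℕ) (φ : G → ℂ) :
    (star (Q.rootVec n) ⬝ᵥ fun x : Q.Slab 0 n => φ x) = Q.rootPairing φ := by
  classical
  have hfin := Q.finite_shell_le n
  have := Q.sum_slab_eq_sum (n := n) (fun x => conj ((Q.root : G → ℂ) x) * φ x) hfin.toFinset
    (by simp)
  refine this.trans (Finset.sum_subset ?_ ?_).symm
  · intro x hx
    simp only [Set.Finite.mem_toFinset, Set.mem_ofPred_eq] at hx ⊢
    omega
  · intro x _ hx
    rw [Q.root_apply_of_ne (by simpa using hx), map_zero, zero_mul]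

theorem inner_root (ψ : EllTwo G) : inner ℂ Q.root ψ = Q.rootPairing ψ := by
  have h := lp.hasSum_inner (𝕜 := ℂ) Q.root ψ
  refine h.unique ?_
  have : ∀ x, inner ℂ ((Q.root : G → ℂ) x) ((ψ : G → ℂ) x) =
      conj ((Q.root : G → ℂ) x) * (ψ : G → ℂ) x := fun x => by
    rw [RCLike.inner_apply, mul_comm]
  simp only [this]
  refine hasSum_sum_of_ne_finset_zero fun x hx => ?_
  rw [Q.root_apply_of_ne (by simpa using hx), map_zero, zero_mul]

/-- The restriction of a function to the first shells sees the rest of `G` only through the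
boundary modes. -/
theorem exists_Hpart_mulVec_restrict (n : ℕ) (z : ℂ) (φ : G → ℂ) :
    ∃ f, (Q.Hpart 0 n - z • 1) *ᵥ (fun x : Q.Slab 0 n => φ x) =
      (fun x : Q.Slab 0 n => H.formal φ x - z * φ x) + Q.ΦEmb 0 n *ᵥ f := by
  classical
  have : Fintype {x // Q.shell x = n + 1} := (Q.shell_finite (n + 1)).fintype
  have hfin := Q.finite_shell_le n
  -- By symmetry of `H`, hopping from shell `n + 1` back to shell `n` is `-Φ_n Υ_{n+1}^*`.
  refine ⟨(Q.Υ (n + 1))ᴴ *ᵥ fun y => φ y, ?_⟩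
  funext x
  have hx := x.2.2
  have h1 : H.formal φ x = ∑ y ∈ hfin.toFinset, H.entry x y * φ y +
      ∑ y ∈ (Q.shell_finite (n + 1)).toFinset, H.entry x y * φ y := by
    rw [H.formal_eq_sum φ x (hfin.toFinset ∪ (Q.shell_finite (n + 1)).toFinset),
      Finset.sum_union]
    · rw [Finset.disjoint_left]
      intro y hy hy'
      simp only [Set.Finite.mem_toFinset, Set.mem_ofPred_eq] at hy hy'
      omega
    · intro y hy _
      by_contra hmem
      simp only [Finset.mem_union, Set.Finite.mem_toFinset, Set.mem_ofPred_eq] at hmem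
      exact hy (Q.entry_eq_zero x y (Or.inl (by omega)))
  have h2 : ∑ y ∈ (Q.shell_finite (n + 1)).toFinset, H.entry x y * φ y =
      ∑ y : {x // Q.shell x = n + 1}, H.entry x y * φ y :=
    Finset.sum_subtype _ (by simp) fun y => H.entry x y * φ y
  have h3 : ((Q.Hpart 0 n) *ᵥ (fun x : Q.Slab 0 n => φ x)) x =
      ∑ y ∈ hfin.toFinset, H.entry x y * φ y :=
    Q.sum_slab_eq_sum (fun y => H.entry x y * φ y) _ (by simp)
  have h4 : ∑ y : {x // Q.shell x = n + 1}, H.entry x y * φ y =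
      -(Q.ΦEmb 0 n *ᵥ ((Q.Υ (n + 1))ᴴ *ᵥ fun y => φ y)) x := by
    by_cases hn : Q.shell x = n
    · rw [Q.ΦEmb_mulVec_of_eq _ _ hn, Matrix.mulVec_mulVec, Matrix.mulVec, dotProduct,
        ← Finset.sum_neg_distrib]
      refine Finset.sum_congr rfl fun y _ => ?_
      have h5 := congrFun (congrFun (Q.factorization n) y) ⟨x, hn⟩
      rw [Matrix.of_apply] at h5
      have h6 : H.entry x y = -(Q.Φ n * (Q.Υ (n + 1))ᴴ) ⟨x, hn⟩ y := by
        rw [H.symmetric, h5, Matrix.neg_apply, map_neg, Matrix.mul_apply, Matrix.mul_apply,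
          map_sum]
        congr 1
        refine Finset.sum_congr rfl fun j _ => ?_
        simp [mul_comm]
      rw [h6, neg_mul]
    · rw [Q.ΦEmb_mulVec_of_ne _ _ hn, neg_zero]
      refine Finset.sum_eq_zero fun y _ => ?_
      have := y.2
      rw [Q.entry_eq_zero x y (Or.inl (by omega)), zero_mul]
  rw [Matrix.sub_mulVec, Matrix.smul_mulVec, Matrix.one_mulVec, Pi.sub_apply, Pi.add_apply, h3,
    h1, h2, h4, Pi.smul_apply, smul_eq_mul]
  ring

theorem mem_weylSet_of_formal {n : ℕ} {z : ℂ} {φ : G → ℂ}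
    (h : ∀ x, Q.shell x ≤ n → H.formal φ x - z * φ x = (Q.root : G → ℂ) x)
    (hle : z.im ^ 2 * ∑ x : Q.Slab 0 n, ‖φ x‖ ^ 2 ≤ z.im * (Q.rootPairing φ).im) :
    Q.rootPairing φ ∈ Q.weylSet n z := by
  obtain ⟨f, hf⟩ := Q.exists_Hpart_mulVec_restrict n z φ
  refine ⟨_, f, ?_, Q.star_rootVec_dotProduct n φ, hle⟩
  rw [hf]
  congr 1
  funext x
  rw [h x x.2.2, rootVec_apply]

/-- Extend the finite solution by zero. The equation survives only strictly below shell `n`, since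
shell `n` carries the term `Φ f`; this is exactly enough for level `n - 1`. -/
theorem exists_formal_of_mem_weylSet {n : ℕ} {z w : ℂ} (h : w ∈ Q.weylSet n z) :
    ∃ φ : G → ℂ, (∀ x, n < Q.shell x → φ x = 0) ∧
      (∀ x, Q.shell x < n → H.formal φ x - z * φ x = (Q.root : G → ℂ) x) ∧
      Q.rootPairing φ = w ∧ z.im ^ 2 * ∑ x : Q.Slab 0 n, ‖φ x‖ ^ 2 ≤ z.im * w.im := by
  classical
  obtain ⟨φ, f, h1, h2, h3⟩ := h
  let φ' : G → ℂ := fun x => if h : Q.shell x ≤ n then φ ⟨x, Nat.zero_le _, h⟩ else 0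
  have hφ : (fun x : Q.Slab 0 n => φ' x) = φ := by
    funext x
    exact dif_pos x.2.2
  refine ⟨φ', fun x hx => dif_neg (by omega), fun x hx => ?_, ?_, ?_⟩
  · have hfin := Q.finite_shell_le n
    have h4 := congrFun h1 ⟨x, Nat.zero_le _, hx.le⟩
    rw [← hφ, Matrix.sub_mulVec, Matrix.smul_mulVec, Matrix.one_mulVec, Pi.sub_apply,
      Pi.add_apply, Q.ΦEmb_mulVec_of_ne _ _ hx.ne, add_zero, rootVec_apply, Pi.smul_apply,
      smul_eq_mul] at h4
    rw [← h4, H.formal_eq_sum φ' x hfin.toFinset]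
    · congr 1
      exact (Q.sum_slab_eq_sum (fun y => H.entry x y * φ' y) _ (by simp)).symm
    · intro y _ hy
      by_contra hmem
      exact hy (dif_neg (by simpa using hmem))
  · rw [← Q.star_rootVec_dotProduct n, hφ, h2]
  · have : ∑ x : Q.Slab 0 n, ‖φ' x‖ ^ 2 = ∑ x : Q.Slab 0 n, ‖φ x‖ ^ 2 := by
      rw [← hφ]
    rwa [this]

theorem sum_slab_le_sum_slab_succ (n : ℕ) (φ : G → ℂ) :
    ∑ x : Q.Slab 0 n, ‖φ x‖ ^ 2 ≤ ∑ x : Q.Slab 0 (n + 1), ‖φ x‖ ^ 2 := by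
  let e : Q.Slab 0 n ↪ Q.Slab 0 (n + 1) :=
    ⟨fun x => ⟨x, x.2.1, x.2.2.trans (Nat.le_succ n)⟩, fun x y h =>
      Subtype.ext (congrArg (fun t : Q.Slab 0 (n + 1) => (t : G)) h)⟩
  have h : ∑ x : Q.Slab 0 n, ‖φ x‖ ^ 2 =
      ∑ x ∈ Finset.univ.map e, ‖φ (x : Q.Slab 0 (n + 1))‖ ^ 2 := by
    rw [Finset.sum_map]
    rfl
  rw [h]
  exact Finset.sum_le_sum_of_subset_of_nonneg (Finset.subset_univ _) fun _ _ _ => by positivity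

theorem weylSet_succ_subset (n : ℕ) (z : ℂ) : Q.weylSet (n + 1) z ⊆ Q.weylSet n z := by
  intro w hw
  obtain ⟨φ, -, h1, rfl, h3⟩ := Q.exists_formal_of_mem_weylSet hw
  refine Q.mem_weylSet_of_formal (fun x hx => h1 x (by omega)) (le_trans ?_ h3)
  have := Q.sum_slab_le_sum_slab_succ n φ
  gcongr

theorem im_nonneg_of_mem_weylSet {n : ℕ} {z w : ℂ} (hz : 0 < z.im) (hw : w ∈ Q.weylSet n z) :
    0 ≤ w.im := by
  obtain ⟨φ, f, -, -, h⟩ := hw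
  have h1 : 0 ≤ z.im * w.im := le_trans (by positivity) h
  exact nonneg_of_mul_nonneg_right h1 hz

/-- If `Im w ≤ 0`, the solution vanishes. For `n ≥ 1` the equation holds on shell `0` without
boundary term, where the root is non-zero; for `n = 0` the boundary term could cancel it. -/
theorem im_pos_of_mem_weylSet {n : ℕ} (hn : 1 ≤ n) {z w : ℂ} (hz : 0 < z.im)
    (hw : w ∈ Q.weylSet n z) : 0 < w.im := by
  obtain ⟨φ, h0, h1, -, h3⟩ := Q.exists_formal_of_mem_weylSet hw
  by_contra! hle
  have h4 : z.im ^ 2 * ∑ x : Q.Slab 0 n, ‖φ x‖ ^ 2 ≤ 0 :=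
    h3.trans (mul_nonpos_of_nonneg_of_nonpos hz.le hle)
  have h5 := sum_norm_sq_eq_zero (φ := fun x : Q.Slab 0 n => φ x)
    (nonpos_of_mul_nonpos_right h4 (by positivity))
  have h6 : φ = 0 := by
    funext x
    by_cases hx : Q.shell x ≤ n
    · exact congrFun h5 ⟨x, Nat.zero_le _, hx⟩
    · exact h0 x (by omega)
  obtain ⟨x, hx, hx0⟩ := Q.exists_root_ne_zero
  apply hx0
  rw [← h1 x (by omega), h6, map_zero]
  simp

end QuasiSphericalPartition

/-! ### Defect and resolvent of symmetric operators. -/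

section SymmetricOperator

variable {E : Type*} [NormedAddCommGroup E] [InnerProductSpace ℂ E]

theorem im_mul_norm_le_of_symmetric {T : E →ₗ.[ℂ] E} (hT : T.IsFormalAdjoint T) (w : ℂ)
    (x : T.domain) : |w.im| * ‖(x : E)‖ ≤ ‖T x - w • (x : E)‖ := by
  rcases eq_or_ne (x : E) 0 with h0 | h0
  · rw [h0, norm_zero, mul_zero]
    exact norm_nonneg _
  have hx : 0 < ‖(x : E)‖ := norm_pos_iff.2 h0
  have h1 : (inner ℂ (x : E) (T x)).im = 0 := by
    have := hT x x
    rw [← inner_conj_symm] at this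
    exact Complex.conj_eq_iff_im.1 this
  have h2 : (inner ℂ (x : E) (T x - w • (x : E))).im = -(w.im * ‖(x : E)‖ ^ 2) := by
    rw [inner_sub_right, inner_smul_right, inner_self_eq_norm_sq_to_K, Complex.sub_im, h1, zero_sub]
    congr 1
    have h3 := Complex.im_mul_ofReal w (‖(x : E)‖ ^ 2)
    rw [Complex.ofReal_pow] at h3
    exact h3
  have h3 : |w.im| * ‖(x : E)‖ ^ 2 ≤ ‖(x : E)‖ * ‖T x - w • (x : E)‖ := by
    calc |w.im| * ‖(x : E)‖ ^ 2 = |(inner ℂ (x : E) (T x - w • (x : E))).im| := by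
          rw [h2, abs_neg, abs_mul, abs_of_nonneg (sq_nonneg ‖(x : E)‖)]
      _ ≤ ‖inner ℂ (x : E) (T x - w • (x : E))‖ := Complex.abs_im_le_norm _
      _ ≤ _ := norm_inner_le_norm _ _
  refine le_of_mul_le_mul_left ?_ hx
  linarith

/-- The range of `T - w` has trivial orthogonal complement. -/
def HasTrivialDefect (T : E →ₗ.[ℂ] E) (w : ℂ) : Prop :=
  ∀ y : E, (∀ x : T.domain, inner ℂ y (T x - w • (x : E)) = 0) → y = 0

theorem HasTrivialDefect.mem_closure_range [CompleteSpace E] {T : E →ₗ.[ℂ] E} {w : ℂ}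
    (h : HasTrivialDefect T w) (y : E) :
    y ∈ closure (Set.range fun x : T.domain => T x - w • (x : E)) := by
  let K := LinearMap.range (T.toFun - w • T.domain.subtype)
  have hK : Kᗮ = ⊥ := by
    rw [Submodule.eq_bot_iff]
    intro y hy
    refine h y fun x => ?_
    rw [Submodule.mem_orthogonal'] at hy
    exact hy _ ⟨x, rfl⟩
  have := Submodule.topologicalClosure_eq_top_iff.2 hK
  have hy : y ∈ K.topologicalClosure := this ▸ Submodule.mem_top
  exact hy

/-- Approximate a defect vector `y` at `w` by `v = (T - w₀) x`. Then `⟨y, v⟩ = (w - w₀) ⟨y, x⟩` and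
`|Im w₀| ‖x‖ ≤ ‖v‖`, so up to an error `‖y‖²` is at most `‖w - w₀‖ / |Im w₀|` times itself. -/
theorem HasTrivialDefect.of_norm_sub_lt [CompleteSpace E] {T : E →ₗ.[ℂ] E}
    (hT : T.IsFormalAdjoint T) {w₀ w : ℂ} (h : HasTrivialDefect T w₀)
    (hw : ‖w - w₀‖ < |w₀.im|) : HasTrivialDefect T w := by
  intro y hy
  have him : 0 < |w₀.im| := (norm_nonneg _).trans_lt hw
  have key : ∀ ε > 0, (|w₀.im| - ‖w - w₀‖) * ‖y‖ ≤ ε := by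
    intro ε' hε'
    set ε := ε' / (2 * |w₀.im|) with hε
    have hεpos : 0 < ε := by positivity
    rcases eq_or_ne y 0 with rfl | h0
    · simpa using hε'.le
    have hypos : 0 < ‖y‖ := norm_pos_iff.2 h0
    obtain ⟨_, ⟨x, rfl⟩, hx⟩ := Metric.mem_closure_iff.1 (h.mem_closure_range y) ε hεpos
    rw [dist_eq_norm] at hx
    dsimp only at hx
    set v := T x - w₀ • (x : E) with hv
    have h1 : inner ℂ y v = (w - w₀) * inner ℂ y (x : E) := by
      have := hy x
      rw [inner_sub_right, inner_smul_right] at this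
      rw [hv, inner_sub_right, inner_smul_right]
      linear_combination this
    have h2 : |w₀.im| * ‖(x : E)‖ ≤ ‖y‖ + ε := by
      refine (im_mul_norm_le_of_symmetric hT w₀ x).trans ?_
      have : v = y - (y - v) := by abel
      rw [← hv, this]
      exact (norm_sub_le _ _).trans (by gcongr)
    have h3 : ‖y‖ ^ 2 ≤ ‖y‖ * ε + ‖w - w₀‖ * (‖y‖ * ‖(x : E)‖) := by
      have e : inner ℂ y y = inner ℂ y (y - v) + (w - w₀) * inner ℂ y (x : E) := by
        rw [← h1, ← inner_add_right, sub_add_cancel]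
      have e2 : ‖inner ℂ y y‖ = ‖y‖ ^ 2 := by
        rw [inner_self_eq_norm_sq_to_K]
        simp
      rw [← e2, e]
      refine (norm_add_le _ _).trans ?_
      rw [norm_mul]
      gcongr
      · exact (norm_inner_le_norm (𝕜 := ℂ) y (y - v)).trans (by gcongr)
      · exact norm_inner_le_norm (𝕜 := ℂ) y (x : E)
    have h4 : ‖y‖ ≤ ε + ‖w - w₀‖ * ‖(x : E)‖ := by
      refine le_of_mul_le_mul_left ?_ hypos
      linarith
    have h5 : ‖w - w₀‖ * (|w₀.im| * ‖(x : E)‖) ≤ ‖w - w₀‖ * ‖y‖ + |w₀.im| * ε := by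
      calc ‖w - w₀‖ * (|w₀.im| * ‖(x : E)‖) ≤ ‖w - w₀‖ * (‖y‖ + ε) := by gcongr
        _ ≤ ‖w - w₀‖ * ‖y‖ + |w₀.im| * ε := by
            rw [mul_add]
            gcongr
    have h6 : |w₀.im| * ‖y‖ ≤ |w₀.im| * (ε + ‖w - w₀‖ * ‖(x : E)‖) := by gcongr
    have h7 : 2 * (|w₀.im| * ε) = ε' := by
      rw [hε]
      field_simp
    linarith
  have h0 : (|w₀.im| - ‖w - w₀‖) * ‖y‖ ≤ 0 := le_of_forall_pos_le_add fun ε hε => by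
    simpa using key ε hε
  exact norm_le_zero_iff.1 (nonpos_of_mul_nonpos_right h0 (by linarith))

/-- Whether a symmetric operator has a defect is constant in each of the half planes. -/
theorem HasTrivialDefect.of_half_plane [CompleteSpace E] {T : E →ₗ.[ℂ] E}
    (hT : T.IsFormalAdjoint T) {σ : ℝ} (hσ : |σ| = 1) (h : HasTrivialDefect T (σ * Complex.I))
    {z : ℂ} (hz : 0 < σ * z.im) : HasTrivialDefect T z := by
  -- Climb the imaginary axis: with ratio `3 / 2` each step is half of the admissible radius.
  have hpow : ∀ k : ℕ, HasTrivialDefect T (((3 / 2 : ℝ) ^ k * σ : ℝ) * Complex.I) := by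
    intro k
    induction k with
    | zero => simpa using h
    | succ k ih =>
      refine ih.of_norm_sub_lt hT ?_
      rw [← sub_mul, ← Complex.ofReal_sub, norm_mul, Complex.norm_I, mul_one, Complex.norm_real,
        Real.norm_eq_abs, Complex.im_ofReal_mul, Complex.I_im,
        mul_one]
      have e : (3 / 2 : ℝ) ^ (k + 1) * σ - (3 / 2) ^ k * σ = 1 / 2 * ((3 / 2) ^ k * σ) := by ring
      rw [e, abs_mul, abs_mul ((3 / 2 : ℝ) ^ k), hσ]
      have : 0 < |(3 / 2 : ℝ) ^ k| := by positivity
      rw [abs_of_pos (by norm_num : (0 : ℝ) < 1 / 2)]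
      linarith
  -- With `t = (3/2)^k`, the bound `t > ‖z‖² / (2 σ Im z)` says exactly that `z` is at distance less
  -- than `t` from `σ t i`.
  obtain ⟨k, hk⟩ := pow_unbounded_of_one_lt (‖z‖ ^ 2 / (2 * (σ * z.im)))
    (by norm_num : (1 : ℝ) < 3 / 2)
  refine (hpow k).of_norm_sub_lt hT ?_
  set t : ℝ := (3 / 2) ^ k with ht
  have htpos : 0 < t := by positivity
  rw [div_lt_iff₀ (by positivity)] at hk
  have hσ2 : σ ^ 2 = 1 := by rw [← sq_abs, hσ, one_pow]
  rw [Complex.im_ofReal_mul, Complex.I_im, mul_one, abs_mul, hσ, mul_one, abs_of_pos htpos,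
    ← sq_lt_sq₀ (norm_nonneg _) htpos.le, ← Complex.normSq_eq_norm_sq, Complex.normSq_apply]
  rw [← Complex.normSq_eq_norm_sq, Complex.normSq_apply] at hk
  simp only [Complex.sub_re, Complex.sub_im, Complex.re_ofReal_mul, Complex.im_ofReal_mul,
    Complex.I_re, Complex.I_im, mul_zero, mul_one, sub_zero]
  nlinarith

theorem exists_adjoint_apply_eq_iff [CompleteSpace E] {T : E →ₗ.[ℂ] E}
    (hT : Dense (T.domain : Set E)) (y χ : E) :
    (∃ h : y ∈ T†.domain, T† ⟨y, h⟩ = χ) ↔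
      ∀ x : T.domain, inner ℂ χ (x : E) = inner ℂ y (T x) := by
  constructor
  · rintro ⟨h, rfl⟩ x
    exact T.adjoint_isFormalAdjoint hT ⟨y, h⟩ x
  · intro h
    have hy := T.mem_adjoint_domain_of_exists y ⟨χ, h⟩
    exact ⟨hy, T.adjoint_apply_eq hT ⟨y, hy⟩ h⟩

theorem dimKer_eq_zero_iff (T : E →ₗ.[ℂ] E) (w : ℂ) :
    dimKer T w = 0 ↔ ∀ y, IsSolution T w y → y = 0 := by
  rw [dimKer, rank_eq_zero_iff]
  constructor
  · rintro h y ⟨hy, hTy⟩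
    obtain ⟨a, ha, h0⟩ := h ⟨⟨y, hy⟩, by
      rw [LinearMap.mem_ker]
      exact sub_eq_zero.2 hTy⟩
    have h1 : a • y = 0 := congrArg (fun v : LinearMap.ker (T.toFun - w • T.domain.subtype) =>
      ((v : T.domain) : E)) h0
    exact (smul_eq_zero.1 h1).resolve_left ha
  · intro h x
    refine ⟨1, one_ne_zero, ?_⟩
    rw [one_smul]
    have := x.2
    rw [LinearMap.mem_ker] at this
    exact Subtype.ext (Subtype.ext (h _ ⟨x.1.2, sub_eq_zero.1 this⟩))

theorem hasTrivialDefect_iff [CompleteSpace E] {T : E →ₗ.[ℂ] E}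
    (hT : Dense (T.domain : Set E)) (w : ℂ) :
    HasTrivialDefect T (conj w) ↔ ∀ y, IsSolution T† w y → y = 0 := by
  refine forall_congr' fun y => ?_
  rw [IsSolution, exists_adjoint_apply_eq_iff hT]
  have : (∀ x : T.domain, inner ℂ y (T x - conj w • (x : E)) = 0) ↔
      ∀ x : T.domain, inner ℂ (w • y) (x : E) = inner ℂ y (T x) := by
    refine forall_congr' fun x => ?_
    rw [inner_sub_right, inner_smul_right, inner_smul_left, sub_eq_zero, eq_comm]
  rw [this]

theorem isFormalAdjoint_of_isSelfAdjoint [CompleteSpace E] {T : E →ₗ.[ℂ] E}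
    (hT : IsSelfAdjoint T) : T.IsFormalAdjoint T := by
  have h := T.adjoint_isFormalAdjoint hT.dense_domain
  rwa [LinearPMap.isSelfAdjoint_def.1 hT] at h

theorem eq_zero_of_isSolution {T : E →ₗ.[ℂ] E} (hT : T.IsFormalAdjoint T) {w : ℂ}
    (hw : w.im ≠ 0) {y : E} (hy : IsSolution T w y) : y = 0 := by
  obtain ⟨h, hTy⟩ := hy
  have h1 := im_mul_norm_le_of_symmetric hT w ⟨y, h⟩
  rw [hTy, sub_self, norm_zero] at h1
  exact norm_le_zero_iff.1 (nonpos_of_mul_nonpos_right h1 (abs_pos.2 hw))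

/-- A self-adjoint operator has a bounded resolvent off the real line. -/
theorem exists_isResolvent [CompleteSpace E] {T : E →ₗ.[ℂ] E} (hT : IsSelfAdjoint T) {z : ℂ}
    (hz : z.im ≠ 0) : ∃ R : E →L[ℂ] E, IsResolvent T z R := by
  have hsym := isFormalAdjoint_of_isSelfAdjoint hT
  have hbound := im_mul_norm_le_of_symmetric hsym z
  have him : 0 < |z.im| := abs_pos.2 hz
  have hdefect : HasTrivialDefect T z := by
    have h := hasTrivialDefect_iff hT.dense_domain (conj z)
    rw [Complex.conj_conj, LinearPMap.isSelfAdjoint_def.1 hT] at h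
    exact h.2 fun y hy => eq_zero_of_isSolution hsym (by simpa using hz) hy
  let S : T.domain →ₗ[ℂ] E := T.toFun - z • T.domain.subtype
  have hS : ∀ x, S x = T x - z • (x : E) := fun x => rfl
  have hinj : Function.Injective S := by
    refine (injective_iff_map_eq_zero S).2 fun x hx => ?_
    have h1 := hbound x
    rw [← hS, hx, norm_zero] at h1
    exact Subtype.ext (norm_le_zero_iff.1 (nonpos_of_mul_nonpos_right h1 him))
  -- The range is dense by the trivial defect and closed by the lower bound together with the closed
  -- graph.
  have hsurj : Function.Surjective S := by
    intro y
    obtain ⟨v, hv, hlim⟩ := mem_closure_iff_seq_limit.1 (hdefect.mem_closure_range y)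
    choose x hx using hv
    replace hx : ∀ n, S (x n) = v n := hx
    have hcauchy : CauchySeq fun n => (x n : E) := by
      rw [Metric.cauchySeq_iff']
      intro ε hε
      obtain ⟨N, hN⟩ := Metric.cauchySeq_iff'.1 hlim.cauchySeq (|z.im| * ε) (by positivity)
      refine ⟨N, fun n hn => ?_⟩
      have h1 := hbound (x n - x N)
      rw [← hS, map_sub, hx, hx, ← dist_eq_norm, Submodule.coe_sub, ← dist_eq_norm] at h1
      exact lt_of_mul_lt_mul_left (h1.trans_lt (hN n hn)) him.le
    obtain ⟨x₀, hx₀⟩ := cauchySeq_tendsto_of_complete hcauchy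
    have hTx : Tendsto (fun n => T (x n)) atTop (𝓝 (y + z • x₀)) := by
      have : (fun n => T (x n)) = fun n => v n + z • (x n : E) := by
        funext n
        rw [← hx, hS, sub_add_cancel]
      rw [this]
      exact hlim.add (hx₀.const_smul z)
    have hmem : (x₀, y + z • x₀) ∈ T.graph := by
      refine IsClosed.mem_of_tendsto hT.isClosed (hx₀.prodMk_nhds hTx)
        (Eventually.of_forall fun n => ?_)
      exact T.mem_graph (x n)
    rw [LinearPMap.mem_graph_iff] at hmem
    obtain ⟨x', h1, h2⟩ := hmem
    refine ⟨x', ?_⟩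
    rw [hS, h2, h1]
    exact add_sub_cancel_right _ _
  let e := LinearEquiv.ofBijective S ⟨hinj, hsurj⟩
  let R : E →L[ℂ] E := (T.domain.subtype ∘ₗ e.symm.toLinearMap).mkContinuous |z.im|⁻¹ fun y => by
    have h1 := hbound (e.symm y)
    have h2 : S (e.symm y) = y := e.apply_symm_apply y
    rw [← hS, h2] at h1
    rw [inv_mul_eq_div, le_div_iff₀ him, mul_comm]
    exact h1
  refine ⟨R, fun y => ⟨(e.symm y).2, ?_⟩, fun y => ?_⟩
  · exact e.apply_symm_apply y
  · exact congrArg Subtype.val (e.symm_apply_apply y)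

end SymmetricOperator

/-! ### The adjoint as the natural action on its maximal domain. -/

namespace HoppingOperator

variable {G : Type*} (H : HoppingOperator G)

theorem dense_compactlySupported : Dense (compactlySupported G : Set (EllTwo G)) := by
  classical
  intro ψ
  have h := lp.hasSum_single (E := fun _ : G => ℂ) (p := 2) (by simp) ψ
  refine mem_closure_of_tendsto h (Eventually.of_forall fun s => ?_)
  refine Submodule.sum_mem _ fun x _ => (Set.finite_singleton x).subset fun y hy => ?_
  by_contra hne
  exact hy (lp.single_apply_ne _ _ _ hne)

/-- Summation by parts. -/
theorem inner_Hmin (ψ : EllTwo G) (φ : compactlySupported G) :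
    inner ℂ ψ (H.Hmin φ) =
      ∑ x ∈ φ.2.toFinset, conj (H.formal ψ x) * ((φ : EllTwo G) : G → ℂ) x := by
  classical
  set f : G → ℂ := ((φ : EllTwo G) : G → ℂ) with hf
  set t : Finset G := φ.2.toFinset with ht
  set s : Finset G := t.biUnion fun x => (H.locallyFinite x).toFinset with hs
  have hmem : ∀ x ∈ t, ∀ y, H.entry x y ≠ 0 → y ∈ s := fun x hx y hy =>
    Finset.mem_biUnion.2 ⟨x, hx, by simpa using hy⟩
  have hft : ∀ x, f x ≠ 0 → x ∈ t := fun x hx => φ.2.mem_toFinset.2 hx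
  have hcol : ∀ y, H.formal f y = ∑ x ∈ t, H.entry y x * f x := fun y =>
    H.formal_eq_sum f y t fun x _ hx => hft x hx
  have h1 : inner ℂ ψ (H.Hmin φ) = ∑ y ∈ s, conj ((ψ : G → ℂ) y) * H.formal f y := by
    refine (lp.hasSum_inner (𝕜 := ℂ) ψ (H.Hmin φ)).unique ?_
    have e : ∀ y, inner ℂ ((ψ : G → ℂ) y) ((H.Hmin φ : G → ℂ) y) =
        conj ((ψ : G → ℂ) y) * H.formal f y := fun y => by
      rw [RCLike.inner_apply, mul_comm]
      rfl
    simp only [e]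
    refine hasSum_sum_of_ne_finset_zero fun y hy => ?_
    rw [hcol, Finset.sum_eq_zero, mul_zero]
    intro x hx
    by_contra h0
    refine hy (hmem x hx y fun h => left_ne_zero_of_mul h0 ?_)
    rw [H.symmetric, h, map_zero]
  rw [h1]
  simp only [hcol, Finset.mul_sum]
  rw [Finset.sum_comm]
  refine Finset.sum_congr rfl fun x hx => ?_
  rw [H.formal_eq_sum ψ x s fun y hy _ => hmem x hx y hy, map_sum, Finset.sum_mul]
  refine Finset.sum_congr rfl fun y _ => ?_
  rw [map_mul, ← H.symmetric]
  ring

theorem inner_compactlySupported (χ : EllTwo G) (φ : compactlySupported G) :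
    inner ℂ χ (φ : EllTwo G) =
      ∑ x ∈ φ.2.toFinset, conj ((χ : G → ℂ) x) * ((φ : EllTwo G) : G → ℂ) x := by
  refine (lp.hasSum_inner (𝕜 := ℂ) χ (φ : EllTwo G)).unique ?_
  have e : ∀ y, inner ℂ ((χ : G → ℂ) y) (((φ : EllTwo G) : G → ℂ) y) =
      conj ((χ : G → ℂ) y) * ((φ : EllTwo G) : G → ℂ) y := fun y => by
    rw [RCLike.inner_apply, mul_comm]
  simp only [e]
  refine hasSum_sum_of_ne_finset_zero fun y hy => ?_
  have : ((φ : EllTwo G) : G → ℂ) y = 0 := by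
    by_contra h0
    exact hy (φ.2.mem_toFinset.2 h0)
  rw [this, mul_zero]

theorem isFormalAdjoint_Hmin : H.Hmin.IsFormalAdjoint H.Hmin := by
  intro ψ φ
  exact (inner_compactlySupported (H.Hmin ψ) φ).trans (H.inner_Hmin ψ φ).symm

theorem dense_domain_Hmin : Dense (H.Hmin.domain : Set (EllTwo G)) :=
  dense_compactlySupported

/-- `H_min^*` is the natural action of `H` on its maximal domain. -/
theorem exists_Hmax_apply_eq_iff (ψ χ : EllTwo G) :
    (∃ h : ψ ∈ H.Hmax.domain, H.Hmax ⟨ψ, h⟩ = χ) ↔ H.formal ψ = χ := by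
  classical
  rw [Hmax, exists_adjoint_apply_eq_iff H.dense_domain_Hmin]
  constructor
  · intro h
    funext x
    have hsupp : Function.support (lp.single 2 x (1 : ℂ) : lp (fun _ : G => ℂ) 2) ⊆ {x} := by
      intro y hy
      by_contra hne
      exact hy (lp.single_apply_ne _ _ _ hne)
    let φ : compactlySupported G := ⟨lp.single 2 x (1 : ℂ), (Set.finite_singleton x).subset hsupp⟩
    have h1 := (inner_compactlySupported χ φ).symm.trans ((h φ).trans (H.inner_Hmin ψ φ))
    have hφ : ((φ : EllTwo G) : G → ℂ) x = 1 := lp.single_apply_self _ _ _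
    have key : ∀ g : G → ℂ, ∑ y ∈ φ.2.toFinset, conj (g y) * ((φ : EllTwo G) : G → ℂ) y =
        conj (g x) := by
      intro g
      rw [Finset.sum_eq_single_of_mem x, hφ, mul_one]
      · exact φ.2.mem_toFinset.2 fun h0 => one_ne_zero (hφ.symm.trans h0)
      · intro y hy hne
        exact absurd (hsupp ((Set.Finite.mem_toFinset _).1 hy)) hne
    rw [key, key] at h1
    exact ((starRingEnd ℂ).injective h1).symm
  · intro h φ
    refine (inner_compactlySupported χ φ).trans (Eq.trans ?_ (H.inner_Hmin ψ φ).symm)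
    rw [h]

theorem isSolution_Hmax_iff (w : ℂ) (ψ : EllTwo G) :
    IsSolution H.Hmax w ψ ↔ ∀ x, H.formal ψ x - w * (ψ : G → ℂ) x = 0 := by
  rw [IsSolution, H.exists_Hmax_apply_eq_iff, funext_iff]
  refine forall_congr' fun x => ?_
  rw [sub_eq_zero]
  rfl

end HoppingOperator

/-! ### The limit of the discs. -/

namespace QuasiSphericalPartition

variable {G : Type*} {H : HoppingOperator G} (Q : QuasiSphericalPartition H)

theorem sum_slab_norm_sq_le (n : ℕ) (ψ : EllTwo G) :
    ∑ x : Q.Slab 0 n, ‖(ψ : G → ℂ) x‖ ^ 2 ≤ ‖ψ‖ ^ 2 := by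
  have h := lp.sum_rpow_le_norm_rpow (p := 2) (by simp) ψ
    (Finset.univ.map (Function.Embedding.subtype fun x : G => 0 ≤ Q.shell x ∧ Q.shell x ≤ n))
  rw [Finset.sum_map] at h
  simpa using h

/-- A point common to all Weyl discs comes from a square summable solution of
`(H - z) ψ = P_0 Υ_0`. -/
theorem exists_of_mem_iInter_weylSet {z w : ℂ} (hz : z.im ≠ 0) (hw : ∀ n, w ∈ Q.weylSet n z) :
    ∃ ψ : EllTwo G, (∀ x, H.formal ψ x - z * (ψ : G → ℂ) x = (Q.root : G → ℂ) x) ∧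
      inner ℂ Q.root ψ = w := by
  classical
  set C := z.im * w.im / z.im ^ 2 with hC
  -- These sets decrease and are compact for pointwise convergence, since the equations and the
  -- pairing involve finite sums and the norm bound `C` does not depend on `n`. A common point
  -- solves the equation everywhere.
  let K : ℕ → Set (G → ℂ) := fun n =>
    {φ | (∀ s : Finset G, ∑ x ∈ s, ‖φ x‖ ^ 2 ≤ C) ∧
      (∀ x, Q.shell x < n → H.formal φ x - z * φ x = (Q.root : G → ℂ) x) ∧ Q.rootPairing φ = w}
  have hclosed : ∀ n, IsClosed (K n) := by
    intro n
    have hform : ∀ x, Continuous fun φ : G → ℂ => H.formal φ x := fun x =>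
      continuous_finsetSum _ fun y _ => continuous_const.mul (continuous_apply y)
    have h1 : IsClosed {φ : G → ℂ | ∀ s : Finset G, ∑ x ∈ s, ‖φ x‖ ^ 2 ≤ C} := by
      simp only [Set.ofPred_forall]
      exact isClosed_iInter fun s => isClosed_le (by fun_prop) continuous_const
    have h2 : IsClosed {φ : G → ℂ | ∀ x, Q.shell x < n →
        H.formal φ x - z * φ x = (Q.root : G → ℂ) x} := by
      simp only [Set.ofPred_forall]
      exact isClosed_iInter fun x => isClosed_iInter fun _ => isClosed_eq
        ((hform x).sub (continuous_const.mul (continuous_apply x))) continuous_const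
    have h3 : IsClosed {φ : G → ℂ | Q.rootPairing φ = w} :=
      isClosed_eq (continuous_finsetSum _ fun y _ => continuous_const.mul (continuous_apply y))
        continuous_const
    exact h1.inter (h2.inter h3)
  have hcompact : IsCompact (K 0) := by
    refine (isCompact_univ_pi fun _ : G => isCompact_closedBall (0 : ℂ) (√C)).of_isClosed_subset
      (hclosed 0) ?_
    rintro φ ⟨h, -, -⟩ x -
    rw [mem_closedBall_zero_iff]
    exact Real.le_sqrt_of_sq_le (by simpa using h {x})
  have hnonempty : ∀ n, (K n).Nonempty := by
    intro n
    obtain ⟨φ, h0, h1, h2, h3⟩ := Q.exists_formal_of_mem_weylSet (hw n)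
    refine ⟨φ, fun s => ?_, h1, h2⟩
    have hle : ∑ x : Q.Slab 0 n, ‖φ x‖ ^ 2 ≤ C := by
      rw [hC, le_div_iff₀ (by positivity), mul_comm]
      exact h3
    refine le_trans ?_ hle
    let t : Finset G := Finset.univ.map
      (Function.Embedding.subtype fun x : G => 0 ≤ Q.shell x ∧ Q.shell x ≤ n)
    have ht : ∑ x : Q.Slab 0 n, ‖φ x‖ ^ 2 = ∑ x ∈ t, ‖φ x‖ ^ 2 := by
      rw [Finset.sum_map]
      rfl
    rw [ht, Finset.sum_subset (Finset.subset_union_left (s₁ := t) (s₂ := s))]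
    · exact Finset.sum_le_sum_of_subset_of_nonneg Finset.subset_union_right
        fun _ _ _ => by positivity
    · intro x _ hx
      have : n < Q.shell x := by
        by_contra! hle'
        exact hx (Finset.mem_map.2 ⟨⟨x, Nat.zero_le _, hle'⟩, Finset.mem_univ _, rfl⟩)
      rw [h0 x this, norm_zero, zero_pow two_ne_zero]
  obtain ⟨φ, hφ⟩ := IsCompact.nonempty_iInter_of_sequence_nonempty_isCompact_isClosed K
    (fun n φ hφ => ⟨hφ.1, fun x hx => hφ.2.1 x (by omega), hφ.2.2⟩) hnonempty hcompact hclosed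
  rw [Set.mem_iInter] at hφ
  have hmem : Memℓp (E := fun _ : G => ℂ) φ 2 :=
    memℓp_gen' (C := C) fun s => by simpa using (hφ 0).1 s
  refine ⟨⟨φ, hmem⟩, fun x => (hφ (Q.shell x + 1)).2.1 x (Nat.lt_succ_self _), ?_⟩
  rw [Q.inner_root]
  exact (hφ 0).2.2

theorem exists_isSolution_of_ne {z w w' : ℂ} (hz : z.im ≠ 0) (hw : ∀ n, w ∈ Q.weylSet n z)
    (hw' : ∀ n, w' ∈ Q.weylSet n z) (hne : w ≠ w') :
    ∃ ψ : EllTwo G, inner ℂ Q.root ψ ≠ 0 ∧ IsSolution H.Hmax z ψ := by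
  obtain ⟨ψ, h1, h2⟩ := Q.exists_of_mem_iInter_weylSet hz hw
  obtain ⟨ψ', h1', h2'⟩ := Q.exists_of_mem_iInter_weylSet hz hw'
  refine ⟨ψ - ψ', ?_, ?_⟩
  · rw [inner_sub_right, h2, h2']
    exact sub_ne_zero.2 hne
  · rw [H.isSolution_Hmax_iff]
    intro x
    rw [lp.coeFn_sub, map_sub, Pi.sub_apply, Pi.sub_apply]
    linear_combination h1 x - h1' x

/-- The truncation of a solution of `H ψ = z ψ` is determined by its boundary data. -/
theorem exists_boundary_data {z : ℂ} (hz : z.im ≠ 0) {ψ : EllTwo G}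
    (hψ : IsSolution H.Hmax z ψ) (n : ℕ) :
    ∃ f, (Q.Hpart 0 n - z • 1)⁻¹ *ᵥ (Q.ΦEmb 0 n *ᵥ f) = fun x : Q.Slab 0 n => (ψ : G → ℂ) x := by
  rw [H.isSolution_Hmax_iff] at hψ
  obtain ⟨f, hf⟩ := Q.exists_Hpart_mulVec_restrict n z ψ
  refine ⟨f, (eq_resolvent_mulVec (Q.isHermitian_Hpart 0 n) hz (hf.trans ?_)).symm⟩
  funext x
  rw [Pi.add_apply, hψ x, zero_add]

/-- In the last estimate the truncations of `ψp` and `ψm` are solutions driven by boundary data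
alone. Its right side depends on `n` only through `ρ`, so the limit can be taken. -/
theorem exists_discs {z : ℂ} (hz : 0 < z.im) (n : ℕ) :
    ∃ (c : ℂ) (ρ : ℝ), 0 ≤ ρ ∧ Q.weylDisc n z = Metric.closedBall c ρ ∧
      Q.weylSet n z = Metric.closedBall c ρ ∧
      Q.weylSet n (conj z) = Metric.closedBall (conj c) ρ ∧
      (0 < ρ ↔ z ∉ Q.ASet 0 n ∧ conj z ∉ Q.ASet 0 n) ∧
      ∀ ψp ψm : EllTwo G, IsSolution H.Hmax z ψp → IsSolution H.Hmax (conj z) ψm →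
        ‖inner ℂ Q.root ψp‖ * ‖inner ℂ Q.root ψm‖ ≤ 2 * z.im * ρ * (‖ψp‖ * ‖ψm‖) := by
  have hzc : (conj z).im ≠ 0 := by simpa using hz.ne'
  obtain ⟨c, ρ, h0, h1, h2, h3, h4, h5⟩ := finiteWeylSet_disc (Q.isHermitian_Hpart 0 n) hz
    (Q.rootVec n) (Q.ΦEmb_injective n)
  refine ⟨c, ρ, h0, ?_, h2, h3, ?_, fun ψp ψm hp hm => ?_⟩
  · rw [Q.weylDisc_eq_closure_moebiusSet n hz.ne', h1]
  · rw [h4, Q.mem_ASet_iff hz.ne', Q.mem_ASet_iff hzc, not_not, not_not]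
  · obtain ⟨f, hf⟩ := Q.exists_boundary_data hz.ne' hp n
    obtain ⟨g, hg⟩ := Q.exists_boundary_data hzc hm n
    have h := h5 f g
    rw [hf, hg, Q.star_rootVec_dotProduct, Q.star_rootVec_dotProduct, ← Q.inner_root,
      ← Q.inner_root] at h
    refine h.trans ?_
    gcongr
    · exact Real.sqrt_le_iff.2 ⟨norm_nonneg _, Q.sum_slab_norm_sq_le n ψp⟩
    · exact Real.sqrt_le_iff.2 ⟨norm_nonneg _, Q.sum_slab_norm_sq_le n ψm⟩

/-- In the limit circle case there are square summable solutions at `z` and at `conj z` which are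
not orthogonal to the root. -/
theorem exists_isSolution_of_limitCircle {z : ℂ} (hz : 0 < z.im) {c : ℂ} {ρ : ℝ} (hρ : 0 < ρ)
    (h : (⋂ n, Q.weylDisc n z) = Metric.closedBall c ρ) :
    (∃ ψ : EllTwo G, inner ℂ Q.root ψ ≠ 0 ∧ IsSolution H.Hmax z ψ) ∧
      ∃ ψ : EllTwo G, inner ℂ Q.root ψ ≠ 0 ∧ IsSolution H.Hmax (conj z) ψ := by
  have hzc : (conj z).im ≠ 0 := by simpa using hz.ne'
  have hmem : ∀ w ∈ Metric.closedBall c ρ, ∀ n, w ∈ Q.weylSet n z ∧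
      conj w ∈ Q.weylSet n (conj z) := by
    intro w hw n
    rw [← h, Set.mem_iInter] at hw
    obtain ⟨c', ρ', -, h1, h2, h3, -⟩ := Q.exists_discs hz n
    have hwn := hw n
    rw [h1] at hwn
    rw [h2, h3]
    refine ⟨hwn, ?_⟩
    rw [Metric.mem_closedBall, Complex.dist_conj_conj]
    exact hwn
  have hc := hmem c (Metric.mem_closedBall_self hρ.le)
  have hc' := hmem (c + ρ) (by simp [abs_of_pos hρ])
  have hne : c ≠ c + ρ := by
    intro h0
    have : (ρ : ℂ) = 0 := by simpa using h0
    exact hρ.ne' (by exact_mod_cast this)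
  exact ⟨Q.exists_isSolution_of_ne hz.ne' (fun n => (hc n).1) (fun n => (hc' n).1) hne,
    Q.exists_isSolution_of_ne hzc (fun n => (hc n).2) (fun n => (hc' n).2)
      ((starRingEnd ℂ).injective.ne hne)⟩

theorem limitCircle_or_limitPoint {z : ℂ} (hz : 0 < z.im) :
    (∃ (c : ℂ) (ρ : ℝ), 0 < ρ ∧ (⋂ n, Q.weylDisc n z) = Metric.closedBall c ρ) ∨
      ∃ w : ℂ, (⋂ n, Q.weylDisc n z) = {w} := by
  choose c ρ h0 h1 h2 h3 h4 h5 using Q.exists_discs hz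
  obtain ⟨c₀, ρ₀, -, hρ₀, h⟩ := iInter_closedBall_of_antitone (c := c) h0 fun n => by
    rw [← h2, ← h2]
    exact Q.weylSet_succ_subset n z
  simp only [h1, h]
  rcases hρ₀.eq_or_lt with rfl | hpos
  · exact Or.inr ⟨c₀, Metric.closedBall_zero⟩
  · exact Or.inl ⟨c₀, ρ₀, hpos, rfl⟩

theorem limitCircle_of_isSolution {z : ℂ} (hz : 0 < z.im) {ψp ψm : EllTwo G}
    (hp0 : inner ℂ Q.root ψp ≠ 0) (hm0 : inner ℂ Q.root ψm ≠ 0)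
    (hp : IsSolution H.Hmax z ψp) (hm : IsSolution H.Hmax (conj z) ψm) :
    ∃ (c : ℂ) (ρ : ℝ), 0 < ρ ∧ (⋂ n, Q.weylDisc n z) = Metric.closedBall c ρ := by
  choose c ρ h0 h1 h2 h3 h4 h5 using Q.exists_discs hz
  obtain ⟨c₀, ρ₀, hlim, hρ₀, h⟩ := iInter_closedBall_of_antitone (c := c) h0 fun n => by
    rw [← h2, ← h2]
    exact Q.weylSet_succ_subset n z
  refine ⟨c₀, ρ₀, ?_, by simp only [h1, h]⟩
  have hle : ‖inner ℂ Q.root ψp‖ * ‖inner ℂ Q.root ψm‖ ≤ 2 * z.im * ρ₀ * (‖ψp‖ * ‖ψm‖) :=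
    ge_of_tendsto' ((hlim.const_mul _).mul_const _) fun n => h5 n ψp ψm hp hm
  refine hρ₀.lt_of_ne ?_
  rintro rfl
  have := norm_pos_iff.2 hp0
  have := norm_pos_iff.2 hm0
  have : 0 < ‖inner ℂ Q.root ψp‖ * ‖inner ℂ Q.root ψm‖ := by positivity
  linarith

/-- A limit circle would give non-zero solutions at both `z` and `conj z`, but one vanishing index
excludes solutions in its whole half plane. -/
theorem limitPoint_of_dimKer_eq_zero {z : ℂ} (hz : 0 < z.im)
    (h : dimKer H.Hmax (-Complex.I) = 0 ∨ dimKer H.Hmax Complex.I = 0) :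
    ∃ w : ℂ, (⋂ n, Q.weylDisc n z) = {w} := by
  refine (Q.limitCircle_or_limitPoint hz).resolve_left ?_
  rintro ⟨c, ρ, hρ, hball⟩
  obtain ⟨⟨ψp, hp0, hp⟩, ψm, hm0, hm⟩ := Q.exists_isSolution_of_limitCircle hz hρ hball
  have hdefect := hasTrivialDefect_iff H.dense_domain_Hmin
  rcases h with h | h
  · rw [dimKer_eq_zero_iff] at h
    have h1 := (hdefect (-Complex.I)).2 h
    have h2 : HasTrivialDefect H.Hmin (conj (conj z)) := by
      refine HasTrivialDefect.of_half_plane H.isFormalAdjoint_Hmin (σ := 1) (by simp)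
        (by simpa using h1) (by simpa using hz)
    exact hm0 (by rw [(hdefect (conj z)).1 h2 ψm hm, inner_zero_right])
  · rw [dimKer_eq_zero_iff] at h
    have h1 := (hdefect Complex.I).2 h
    have h2 : HasTrivialDefect H.Hmin (conj z) := by
      refine HasTrivialDefect.of_half_plane H.isFormalAdjoint_Hmin (σ := -1) (by simp)
        (by simpa using h1) (by simpa using hz)
    exact hp0 (by rw [(hdefect z).1 h2 ψp hp, inner_zero_right])

theorem inner_resolvent_mem_weylDisc {z : ℂ} (hz : 0 < z.im) (hH : IsSelfAdjoint H.Hmax)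
    {R : EllTwo G →L[ℂ] EllTwo G} (hR : IsResolvent H.Hmax z R) (n : ℕ) :
    inner ℂ Q.root (R Q.root) ∈ Q.weylDisc n z := by
  obtain ⟨c, ρ, -, h1, h2, -⟩ := Q.exists_discs hz n
  rw [h1, ← h2]
  obtain ⟨hmem, hφ⟩ := hR.1 Q.root
  set φ := R Q.root with hφdef
  have hform : H.formal φ = (Q.root + z • φ : EllTwo G) :=
    (H.exists_Hmax_apply_eq_iff _ _).1 ⟨hmem, by rw [← hφ, sub_add_cancel]⟩
  -- Insert `(H - z) φ` for the root. The disc inequality holds with equality for the full norm,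
  -- hence for every truncation.
  have him : (inner ℂ Q.root φ).im = z.im * ‖φ‖ ^ 2 := by
    have hreal : (inner ℂ (H.Hmax ⟨φ, hmem⟩) φ).im = 0 := by
      have := isFormalAdjoint_of_isSelfAdjoint hH ⟨φ, hmem⟩ ⟨φ, hmem⟩
      rw [← inner_conj_symm φ] at this
      exact Complex.conj_eq_iff_im.1 this.symm
    nth_rewrite 1 [← hφ]
    rw [inner_sub_left, inner_smul_left, inner_self_eq_norm_sq_to_K, Complex.sub_im, hreal,
      zero_sub]
    have : (conj z * ((‖φ‖ ^ 2 : ℝ) : ℂ)).im = -(z.im * ‖φ‖ ^ 2) := by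
      rw [Complex.im_mul_ofReal, Complex.conj_im, neg_mul]
    rw [← neg_eq_iff_eq_neg] at this
    rw [← this]
    push_cast
    rfl
  rw [Q.inner_root] at him ⊢
  refine Q.mem_weylSet_of_formal (fun x _ => ?_) ?_
  · rw [hform, lp.coeFn_add, lp.coeFn_smul]
    simp
  · rw [him]
    have := Q.sum_slab_norm_sq_le n φ
    have h3 : 0 < z.im ^ 2 := by positivity
    nlinarith

end QuasiSphericalPartition

/-! ### The main theorem. -/

theorem theorem2 {G : Type*} (H : HoppingOperator G) (Q : QuasiSphericalPartition H)
    (hA1 : Q.AssumptionA1) (hA2 : Q.AssumptionA2) (z : ℂ) (hz : 0 < z.im) :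
    -- (i) closed discs in the upper half plane, nested, with a limit disc or a limit point
    ((∀ n, ∃ (c : ℂ) (ρ : ℝ), 0 ≤ ρ ∧ Q.weylDisc n z = Metric.closedBall c ρ ∧
        (0 < ρ ↔ z ∉ Q.ASet 0 n ∧ conj z ∉ Q.ASet 0 n)) ∧
      (∀ n, ∀ w ∈ Q.weylDisc n z, 0 ≤ w.im) ∧
      (∀ n, 1 ≤ n → ∀ w ∈ Q.weylDisc n z, 0 < w.im) ∧
      (∀ n, Q.weylDisc (n + 1) z ⊆ Q.weylDisc n z) ∧
      ((∃ (c : ℂ) (ρ : ℝ), 0 < ρ ∧ (⋂ n, Q.weylDisc n z) = Metric.closedBall c ρ) ∨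
        ∃ w : ℂ, (⋂ n, Q.weylDisc n z) = {w})) ∧
    -- (ii) vanishing deficiency index, and the self-adjoint case
    ((dimKer H.Hmax (-Complex.I) = 0 ∨ dimKer H.Hmax Complex.I = 0 →
        ∃ w : ℂ, (⋂ n, Q.weylDisc n z) = {w}) ∧
      (IsSelfAdjoint H.Hmax → ∃ R : EllTwo G →L[ℂ] EllTwo G, IsResolvent H.Hmax z R ∧
        {inner ℂ Q.root (R Q.root)} = ⋂ n, Q.weylDisc n z)) ∧
    -- (iii) characterization of the limit disc case
    (z ∉ ⋃ n, Q.ASet n n → conj z ∉ ⋃ n, Q.ASet n n →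
      ((∃ (c : ℂ) (ρ : ℝ), 0 < ρ ∧ (⋂ n, Q.weylDisc n z) = Metric.closedBall c ρ) ↔
        ∃ ψp ψm : EllTwo G, inner ℂ Q.root ψp ≠ 0 ∧ inner ℂ Q.root ψm ≠ 0 ∧
          IsSolution H.Hmax z ψp ∧ IsSolution H.Hmax (conj z) ψm)) := by
  have hdisc : ∀ n, Q.weylDisc n z = Q.weylSet n z := fun n => by
    obtain ⟨c, ρ, -, h1, h2, -⟩ := Q.exists_discs hz n
    rw [h1, h2]
  refine ⟨⟨fun n => ?_, fun n w hw => ?_, fun n hn w hw => ?_, fun n => ?_,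
    Q.limitCircle_or_limitPoint hz⟩, ⟨Q.limitPoint_of_dimKer_eq_zero hz, fun hH => ?_⟩,
    fun _ _ => ⟨?_, ?_⟩⟩
  · obtain ⟨c, ρ, h0, h1, -, -, h4, -⟩ := Q.exists_discs hz n
    exact ⟨c, ρ, h0, h1, h4⟩
  · exact Q.im_nonneg_of_mem_weylSet hz (hdisc n ▸ hw)
  · exact Q.im_pos_of_mem_weylSet hn hz (hdisc n ▸ hw)
  · rw [hdisc, hdisc]
    exact Q.weylSet_succ_subset n z
  · obtain ⟨R, hR⟩ := exists_isResolvent hH hz.ne'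
    have hsym := isFormalAdjoint_of_isSelfAdjoint hH
    obtain ⟨w, hw⟩ := Q.limitPoint_of_dimKer_eq_zero hz (Or.inr
      ((dimKer_eq_zero_iff _ _).2 fun y hy => eq_zero_of_isSolution hsym (by simp) hy))
    have hmem : inner ℂ Q.root (R Q.root) ∈ ⋂ n, Q.weylDisc n z :=
      Set.mem_iInter.2 (Q.inner_resolvent_mem_weylDisc hz hH hR)
    refine ⟨R, hR, ?_⟩
    rw [hw, Set.mem_singleton_iff] at hmem
    rw [hw, hmem]
  · rintro ⟨c, ρ, hρ, h⟩
    obtain ⟨⟨ψp, hp0, hp⟩, ψm, hm0, hm⟩ := Q.exists_isSolution_of_limitCircle hz hρ h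
    exact ⟨ψp, ψm, hp0, hm0, hp, hm⟩
  · rintro ⟨ψp, ψm, hp0, hm0, hp, hm⟩
    exact Q.limitCircle_of_isSolution hz hp0 hm0 hp hm
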